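/- Let $d\in\mathbb N$, $1\le p<\infty$, let $L^p(\mathbb R^d)$ be the real or complex Lebesgue space with norm $\|\cdot\|$, and let $k\in L^1_{\mathrm{loc}}([0,\infty))$ be completely monotone on $(0,\infty)$. Put $m=1+k$ and $\varphi^m(\lambda)=1/\hat m(\lambda)$ for $\lambda>0$, where $\hat{\ }$ is the Laplace transform. Let $w$ be the propagation function of $m$: for each $\tau\ge0$, $w(\cdot,\tau)$ is the unique nondecreasing, left-continuous function on $[0,\infty)$ with $w(0,\tau)=0$ and $\int_0^\infty e^{-\lambda t}w(t,\tau)\,dt=\lambda^{-1}e^{-\tau\varphi^m(\lambda)}$ for all $\lambda>0$. Let $e^{\tau\Delta}$ be the heat semigroup on $L^p(\mathbb R^d)$ and let $$S(t)v=-\int_0^\infty e^{\tau\Delta}v\;d_\tau w(t,\tau),\qquad t\ge0,\ v\in L^p(\mathbb R^d)$$ (with $w(t,\tau)$ read as $1$ for $\tau<0$ in the Stieltjes measure, so that $S(0)=I$); these are the solution operators of $\partial_tu-(1+\partial_t^{*k})\Delta u=0$, $u(0)=v$, where $\partial_t^{*k}g(t)=\frac{d}{dt}\int_0^tk(t-s)g(s)\,ds$.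 Let $f:L^p(\mathbb R^d)\to L^p(\mathbb R^d)$ satisfy $(F_f)$: $f(0)=0$ and there is $L_f>0$ with $\|f(u)-f(v)\|\le L_f\|u-v\|$ for all $u,v\in L^p(\mathbb R^d)$. Let $\mathcal C=C([0,\infty);L^p(\mathbb R^d))$, with the metric of uniform convergence on compact sets $$\rho(\varphi,h)=\sum_{n=1}^\infty\frac1{2^n}\,\frac{\sup_{t\in[0,n]}\|\varphi(t)-h(t)\|}{1+\sup_{t\in[0,n]}\|\varphi(t)-h(t)\|}.$$ **Theorem.** For every $\varphi\in\mathcal C$ there is a unique $u_\varphi\in\mathcal C$ with $$u_\varphi(t)=\varphi(t)+\int_0^tS(t-s)f(u_\varphi(s))\,ds\qquad(t\ge0).$$ For $t\ge0$ and $\varphi\in\mathcal C$ the formula $$(T_t\varphi)(\theta)=\varphi(t+\theta)+\int_0^tS(t+\theta-\tau)f(u_\varphi(\tau))\,d\tau\qquad(\theta\ge0)$$ is well defined (the integrand is integrable) and defines an element $T_t\varphi$ of $\mathcal C$. The operators $T_t:\mathcal C\to\mathcal C$ form a semigroup of Lipschitz maps of $(\mathcal C,\rho)$: $T_0=I$;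 $T_{t+s}=T_t\circ T_s$ for all $t,s\ge0$; and for every $t\ge0$ there is a constant $K\ge0$ with $\rho(T_t\varphi,T_t\psi)\le K\rho(\varphi,\psi)$ for all $\varphi,\psi\in\mathcal C$. -/

import Mathlib

open MeasureTheory Set
open scoped NNReal ENNReal

namespace RayleighStokes

noncomputable section

/-- The space `L^p(ℝ^d)` with values in `𝕜 = ℝ` or `ℂ`. -/
abbrev LpSpace (𝕜 : Type) [RCLike 𝕜] (d : ℕ) (p : ℝ≥0∞) : Type :=
  Lp 𝕜 p (volume : Measure (EuclideanSpace ℝ (Fin d)))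

/-- The space `𝒞` of all continuous functions `[0, ∞) → L^p(ℝ^d)`. -/
abbrev PathSpace (𝕜 : Type) [RCLike 𝕜] (d : ℕ) (p : ℝ≥0∞) [Fact (1 ≤ p)] : Type :=
  C(ℝ≥0, LpSpace 𝕜 d p)

/-! ### Kernels and propagation functions -/

/-- `k` is completely monotone on `(0, ∞)`: it is smooth there and `(-1)^n k^{(n)} ≥ 0` there. -/
def IsCompletelyMonotone (k : ℝ → ℝ) : Prop :=
  ContDiffOn ℝ (⊤ : ℕ∞) k (Ioi 0) ∧
    ∀ (n : ℕ) (t : ℝ), 0 < t → 0 ≤ (-1) ^ n * iteratedDerivWithin n k (Ioi 0) t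

/-- `k ∈ L^1_loc`, including integrability near the left end point `0`. -/
def IsLocallyIntegrableKernel (k : ℝ → ℝ) : Prop :=
  ∀ R : ℝ, 0 < R → IntegrableOn k (Ioc 0 R)

/-- The Laplace transform `∫_0^∞ e^{-λt} g(t) dt`. -/
def laplace (g : ℝ → ℝ) (lam : ℝ) : ℝ :=
  ∫ t in Ioi (0 : ℝ), Real.exp (-(lam * t)) * g t

/-- The function `φ^m(λ) = 1 / m̂(λ)`. -/
def laplaceExponent (m : ℝ → ℝ) (lam : ℝ) : ℝ := 1 / laplace m lam

/-- `w` is the propagation function of the kernel `m`: for every `τ ≥ 0` the function `w(·, τ)` is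
nondecreasing and left-continuous on `[0, ∞)`, vanishes at `0`, and has the Laplace transform
`λ ↦ e^{-τ φ^m(λ)} / λ`. By uniqueness of the Laplace transform there is at most one such function
on `[0, ∞) × [0, ∞)`. -/
def IsPropagationFunction (m : ℝ → ℝ) (w : ℝ → ℝ → ℝ) : Prop :=
  ∀ τ : ℝ, 0 ≤ τ →
    MonotoneOn (fun t => w t τ) (Ici 0) ∧
    w 0 τ = 0 ∧
    (∀ t : ℝ, 0 < t → ContinuousWithinAt (fun r => w r τ) (Iic t) t) ∧
    ∀ lam : ℝ, 0 < lam →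
      IntegrableOn (fun t => Real.exp (-(lam * t)) * w t τ) (Ioi 0) ∧
      laplace (fun t => w t τ) lam = Real.exp (-(τ * laplaceExponent m lam)) / lam

open Classical in
/-- The propagation function `w(t, τ)` of the kernel `m` (for completely positive `m`, so in
particular for `m = 1 + k` with `k` completely monotone, it exists by Bernstein's theorem). -/
def propagation (m : ℝ → ℝ) : ℝ → ℝ → ℝ :=
  if h : ∃ w, IsPropagationFunction m w then h.choose else fun _ _ => 0

/-- The function `τ ↦ -w(t, τ)`, continued by the value `-1` to `τ < 0`. -/
def negPropagation (m : ℝ → ℝ) (t τ : ℝ) : ℝ :=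
  if τ < 0 then -1 else -propagation m t τ

open Classical in
/-- The Lebesgue-Stieltjes measure `-d_τ w(t, τ)`, for `t ≥ 0` (the function `w(t, ·)` is
nonincreasing with values in `[0, 1]`). It is carried by `[0, ∞)`; for `t = 0`, where
`w(0, τ) = 0` for all `τ > 0`, it is the Dirac measure at `0`. -/
def propagationMeasure (m : ℝ → ℝ) (t : ℝ) : Measure ℝ :=
  if h : Monotone (negPropagation m t) then h.stieltjesFunction.measure else 0

/-! ### The heat semigroup and the solution operators -/

/-- The Gaussian heat kernel `G(τ, y) = (4πτ)^{-d/2} e^{-|y|²/(4τ)}` on `ℝ^d`. -/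
def heatKernel (d : ℕ) (τ : ℝ) (y : EuclideanSpace ℝ (Fin d)) : ℝ :=
  (4 * Real.pi * τ) ^ (-(d : ℝ) / 2) * Real.exp (-‖y‖ ^ 2 / (4 * τ))

variable {𝕜 : Type} [RCLike 𝕜] {d : ℕ} {p : ℝ≥0∞}

/-- The translate `x ↦ v(x - y)`. -/
def translate (y : EuclideanSpace ℝ (Fin d)) (v : LpSpace 𝕜 d p) : LpSpace 𝕜 d p :=
  Lp.compMeasurePreserving (fun x => x - y) (measurePreserving_sub_right volume y) v

variable [Fact (1 ≤ p)]

/-- The heat semigroup `T(τ) = e^{τΔ}` on `L^p(ℝ^d)`: `T(0) = I`, and for `τ > 0` it is the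
convolution with the heat kernel, `T(τ)v = ∫ G(τ, y) v(· - y) dy`, an `L^p`-valued integral. -/
def heatSemigroup (τ : ℝ) (v : LpSpace 𝕜 d p) : LpSpace 𝕜 d p :=
  if τ ≤ 0 then v else ∫ y : EuclideanSpace ℝ (Fin d), heatKernel d τ y • translate y v

/-- The solution operators `S(t)v = -∫_0^∞ T(τ)v d_τ w(t, τ)`, where `w` is the propagation function
of the kernel `m = 1 + k`. -/
def solutionOperator (k : ℝ → ℝ) (t : ℝ) (v : LpSpace 𝕜 d p) : LpSpace 𝕜 d p :=
  ∫ τ, heatSemigroup τ v ∂(propagationMeasure (fun r => 1 + k r) t)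

/-! ### The nonlinear equation and the metric -/

/-- Condition `(F_f)`: `f(0) = 0` and `f` is globally Lipschitz continuous on `L^p(ℝ^d)`. -/
def ConditionFf (f : LpSpace 𝕜 d p → LpSpace 𝕜 d p) : Prop :=
  f 0 = 0 ∧ ∃ L : ℝ, 0 < L ∧ ∀ u v, ‖f u - f v‖ ≤ L * ‖u - v‖

/-- The integrand `τ ↦ S(r - τ) f(u(τ))`, for `0 ≤ τ ≤ r`. -/
def duhamelIntegrand (k : ℝ → ℝ) (f : LpSpace 𝕜 d p → LpSpace 𝕜 d p) (u : PathSpace 𝕜 d p)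
    (r τ : ℝ) : LpSpace 𝕜 d p :=
  solutionOperator k (r - τ) (f (u τ.toNNReal))

/-- `u ∈ 𝒞` is a generalized mild solution for `φ`:
`u(t) = φ(t) + ∫_0^t S(t - s) f(u(s)) ds` for all `t ≥ 0`. -/
def IsGeneralizedMildSolution (k : ℝ → ℝ) (f : LpSpace 𝕜 d p → LpSpace 𝕜 d p)
    (φ u : PathSpace 𝕜 d p) : Prop :=
  ∀ t : ℝ≥0,
    IntervalIntegrable (duhamelIntegrand k f u t) volume 0 t ∧
    u t = φ t + ∫ s in (0 : ℝ)..t, duhamelIntegrand k f u t s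

/-- `sup_{t ∈ [0, n]} ‖φ(t) - h(t)‖`. -/
def supDist (n : ℕ) (φ h : PathSpace 𝕜 d p) : ℝ :=
  sSup ((fun t : ℝ≥0 => ‖φ t - h t‖) '' Icc 0 (n : ℝ≥0))

/-- The metric `ρ(φ, h) = ∑_{n ≥ 1} 2^{-n} ρ_n(φ, h)` of uniform convergence on compact sets, where
`ρ_n = s_n / (1 + s_n)` with `s_n = sup_{t ∈ [0, n]} ‖φ(t) - h(t)‖`. -/
def rho (φ h : PathSpace 𝕜 d p) : ℝ :=
  ∑' n : ℕ, (1 / 2 ^ (n + 1)) * (supDist (n + 1) φ h / (1 + supDist (n + 1) φ h))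

end

end RayleighStokes

/-!
A completely monotone kernel `m = 1 + k` is positive, nonincreasing and log-convex. By Kaluza's
theorem the renewal coefficients of a log-convex sequence are nonnegative, so sampling `m` on grids
of step `h → 0` exhibits `exp (-τ / m̂(λ))` as the Laplace transform of a law on `[0, ∞]`, whose
distribution function is `w(·, τ)`. These laws form a convolution semigroup in `τ`, hence `w(t, ·)`
is nonincreasing and `-d_τ w(t, τ)` is a measure of mass at most one. As the heat semigroup consists
of contractions, so does the family `S(t)`, which depends measurably on `t`.

For a measurable family of `L`-Lipschitz maps the Duhamel integral is a contraction with constant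
`1/2` in the norms weighted by `exp (-2Lt)`. This gives existence, uniqueness and Lipschitz
dependence of the solutions. By uniqueness, the solution for `T_s φ` is the solution for `φ` shifted
by `s`, and the semigroup law follows by splitting the Duhamel integral at `s`.
-/

namespace RayleighStokes

open Filter Topology Polynomial unitInterval
open Finset.HasAntidiagonal (antidiagonal mem_antidiagonal)

/-! ### Log-convexity of completely monotone functions -/

/-- Positive, nonincreasing, locally integrable kernels on `(0, ∞)` with convex logarithm. They
contain the kernels `1 + k` with `k` completely monotone and are the class for which the propagation
function is constructed here. Log-convexity is encoded through equally spaced points. -/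
structure IsLogConvexKernel (m : ℝ → ℝ) : Prop where
  pos : ∀ t, 0 < t → 0 < m t
  antitoneOn : AntitoneOn m (Ioi 0)
  sq_le_mul : ∀ t h, 0 < t → 0 ≤ h → m (t + h) ^ 2 ≤ m t * m (t + 2 * h)
  locallyIntegrable : IsLocallyIntegrableKernel m

/-- The linear functional on polynomials with the moments `a n`, that is, `X ^ n ↦ a n`. -/
noncomputable def momentFunctional (a : ℕ → ℝ) : ℝ[X] →ₗ[ℝ] ℝ :=
  (Polynomial.basisMonomials ℝ).constr ℝ a

theorem momentFunctional_X_pow (a : ℕ → ℝ) (n : ℕ) : momentFunctional a (X ^ n) = a n := by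
  rw [momentFunctional, ← monomial_one_right_eq_X_pow]
  simpa using (Polynomial.basisMonomials ℝ).constr_basis ℝ a n

theorem momentFunctional_one_sub_X_mul (a : ℕ → ℝ) (p : ℝ[X]) :
    momentFunctional a ((1 - X) * p) = momentFunctional (fun n => a n - a (n + 1)) p := by
  induction p using Polynomial.induction_on' with
  | add p q hp hq => rw [mul_add, map_add, map_add, hp, hq]
  | monomial n c =>
    rw [← smul_X_eq_monomial, mul_smul_comm, map_smul, map_smul, momentFunctional_X_pow, sub_mul,
      one_mul, ← pow_succ', map_sub, momentFunctional_X_pow, momentFunctional_X_pow]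

theorem momentFunctional_X_sub_C_sq (a : ℕ → ℝ) (c : ℝ) :
    momentFunctional a ((X - C c) ^ 2) = a 0 * (c * c) + -2 * a 1 * c + a 2 := by
  have expand : (X - C c) ^ 2 = X ^ 2 - (2 * c) • X ^ 1 + (c * c) • (X ^ 0 : ℝ[X]) := by
    simp only [smul_eq_C_mul, C_mul, map_ofNat]
    ring
  rw [expand, map_add, map_sub, map_smul, map_smul]
  simp only [momentFunctional_X_pow, smul_eq_mul]
  ring

theorem sum_sub_sq_smul_bernsteinPolynomial (n : ℕ) (c : ℝ) :
    ∑ ν ∈ Finset.range (n + 1), ((ν : ℝ) - n * c) ^ 2 • bernsteinPolynomial ℝ n ν =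
      (n : ℝ) ^ 2 • (X - C c) ^ 2 + (n : ℝ) • (X - X ^ 2) := by
  have sum_one := bernsteinPolynomial.sum ℝ n
  have sum_index := bernsteinPolynomial.sum_smul ℝ n
  have variance := bernsteinPolynomial.variance ℝ n
  simp only [nsmul_eq_mul] at sum_index variance
  have shift : ∀ ν : ℕ, ((ν : ℝ) - n * c) ^ 2 • bernsteinPolynomial ℝ n ν =
      ((n : ℝ[X]) * X - (ν : ℝ[X])) ^ 2 * bernsteinPolynomial ℝ n ν
        - ((n : ℝ[X]) * (X - C c)) ^ 2 * bernsteinPolynomial ℝ n ν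
        + 2 * ((n : ℝ[X]) * (X - C c)) * ((ν : ℝ[X]) * bernsteinPolynomial ℝ n ν
          - (n : ℝ[X]) * C c * bernsteinPolynomial ℝ n ν) := by
    intro ν
    simp only [smul_eq_C_mul, map_pow, map_sub, map_mul, map_natCast]
    ring
  simp only [shift, Finset.sum_add_distrib, Finset.sum_sub_distrib, ← Finset.mul_sum, sum_one,
    sum_index, variance, smul_eq_C_mul, map_pow, map_natCast]
  ring

/-- By the Bernstein identity above, `n²(X - c)² + n(X - X²)` is a positive combination of
Bernstein polynomials; divide by `n²` and let `n → ∞`. -/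
theorem momentFunctional_X_sub_C_sq_nonneg {a : ℕ → ℝ}
    (ha : ∀ i j, 0 ≤ momentFunctional a ((1 - X) ^ i * X ^ j)) (c : ℝ) :
    0 ≤ momentFunctional a ((X - C c) ^ 2) := by
  set q := momentFunctional a ((X - C c) ^ 2)
  set r := momentFunctional a (X - X ^ 2)
  have bernstein_nonneg (n ν : ℕ) : 0 ≤ momentFunctional a (bernsteinPolynomial ℝ n ν) := by
    rw [bernsteinPolynomial, mul_assoc, mul_comm (X ^ ν), ← nsmul_eq_mul, map_nsmul]
    exact nsmul_nonneg (ha _ _) _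
  have sum_nonneg (n : ℕ) : 0 ≤ (n : ℝ) ^ 2 * q + n * r := by
    have := congrArg (momentFunctional a) (sum_sub_sq_smul_bernsteinPolynomial n c)
    simp only [map_sum, map_add, map_smul, smul_eq_mul] at this
    rw [← this]
    exact Finset.sum_nonneg fun ν _ => mul_nonneg (sq_nonneg _) (bernstein_nonneg n ν)
  have limit : Tendsto (fun n : ℕ => q + r * (1 / (n : ℝ))) atTop (𝓝 (q + r * 0)) :=
    (tendsto_one_div_atTop_nhds_zero_nat.const_mul _).const_add _
  rw [mul_zero, add_zero] at limit
  refine ge_of_tendsto limit ((eventually_gt_atTop 0).mono fun n hn => ?_)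
  have scale : q + r * (1 / (n : ℝ)) = ((n : ℝ) ^ 2 * q + n * r) / n ^ 2 := by field_simp
  exact scale ▸ div_nonneg (sum_nonneg n) (by positivity)

theorem sq_le_mul_of_momentFunctional_nonneg {a : ℕ → ℝ}
    (ha : ∀ i j, 0 ≤ momentFunctional a ((1 - X) ^ i * X ^ j)) : a 1 ^ 2 ≤ a 0 * a 2 := by
  have := discrim_le_zero fun c =>
    momentFunctional_X_sub_C_sq a c ▸ momentFunctional_X_sub_C_sq_nonneg ha c
  rw [discrim] at this
  linarith

namespace IsCompletelyMonotone

variable {k : ℝ → ℝ}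

theorem neg_one_pow_mul_iteratedDeriv_nonneg (hk : IsCompletelyMonotone k) (n : ℕ) {t : ℝ}
    (ht : 0 < t) : 0 ≤ (-1) ^ n * iteratedDeriv n k t := by
  rw [← iteratedDerivWithin_of_isOpen isOpen_Ioi (mem_Ioi.2 ht)]
  exact hk.2 n t ht

theorem contDiffAt (hk : IsCompletelyMonotone k) {t : ℝ} (ht : 0 < t) (n : ℕ) :
    ContDiffAt ℝ n k t :=
  (hk.1.contDiffAt (isOpen_Ioi.mem_nhds ht)).of_le (by exact_mod_cast le_top)

theorem nonneg (hk : IsCompletelyMonotone k) {t : ℝ} (ht : 0 < t) : 0 ≤ k t := by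
  simpa using hk.neg_one_pow_mul_iteratedDeriv_nonneg 0 ht

theorem antitoneOn_iteratedDeriv (hk : IsCompletelyMonotone k) (n : ℕ) :
    AntitoneOn (fun t => (-1) ^ n * iteratedDeriv n k t) (Ioi 0) := by
  have differentiable {t : ℝ} (ht : 0 < t) : DifferentiableAt ℝ (iteratedDeriv n k) t := by
    have within := hk.1.differentiableOn_iteratedDerivWithin (m := n)
      (by exact_mod_cast WithTop.coe_lt_top _) (uniqueDiffOn_Ioi 0)
    refine (within.differentiableAt (isOpen_Ioi.mem_nhds ht)).congr_of_eventuallyEq ?_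
    filter_upwards [isOpen_Ioi.mem_nhds ht] with s hs
    rw [iteratedDerivWithin_of_isOpen isOpen_Ioi hs]
  refine antitoneOn_of_deriv_nonpos (convex_Ioi 0)
    (fun t ht => ((differentiable ht).const_mul _).continuousAt.continuousWithinAt) ?_ ?_
  · rw [interior_Ioi]
    exact fun t ht => ((differentiable ht).const_mul _).differentiableWithinAt
  · rw [interior_Ioi]
    intro t ht
    have := hk.neg_one_pow_mul_iteratedDeriv_nonneg (n + 1) ht
    rw [deriv_const_mul _ (differentiable ht), ← iteratedDeriv_succ]
    rw [pow_succ] at this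
    linarith

theorem antitoneOn (hk : IsCompletelyMonotone k) : AntitoneOn k (Ioi 0) := by
  simpa using hk.antitoneOn_iteratedDeriv 0

theorem sub_shift (hk : IsCompletelyMonotone k) {h : ℝ} (hh : 0 ≤ h) :
    IsCompletelyMonotone fun t => k t - k (t + h) := by
  refine ⟨hk.1.sub (hk.1.comp (by fun_prop) fun t ht => ?_), fun n t ht => ?_⟩
  · exact mem_Ioi.2 (by linarith [mem_Ioi.1 ht])
  · have hth : 0 < t + h := by linarith
    have contDiffAt_shift : ContDiffAt ℝ n (fun s => k (s + h)) t :=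
      ContDiffAt.comp (g := k) t (hk.contDiffAt hth n) (by fun_prop)
    rw [iteratedDerivWithin_of_isOpen isOpen_Ioi (mem_Ioi.2 ht),
      iteratedDeriv_fun_sub (hk.contDiffAt ht n) contDiffAt_shift, iteratedDeriv_comp_add_const,
      mul_sub, sub_nonneg]
    exact hk.antitoneOn_iteratedDeriv n (mem_Ioi.2 ht) (mem_Ioi.2 hth) (by linarith)

theorem momentFunctional_nonneg (hk : IsCompletelyMonotone k) {t h : ℝ} (ht : 0 < t) (hh : 0 ≤ h)
    (i j : ℕ) : 0 ≤ momentFunctional (fun n => k (t + n * h)) ((1 - X) ^ i * X ^ j) := by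
  induction i generalizing k with
  | zero =>
    rw [pow_zero, one_mul, momentFunctional_X_pow]
    exact hk.nonneg (by positivity)
  | succ i ih =>
    rw [pow_succ', mul_assoc, momentFunctional_one_sub_X_mul]
    convert ih (hk.sub_shift hh) using 6
    push_cast
    ring

theorem sq_le_mul (hk : IsCompletelyMonotone k) {t h : ℝ} (ht : 0 < t) (hh : 0 ≤ h) :
    k (t + h) ^ 2 ≤ k t * k (t + 2 * h) := by
  simpa using sq_le_mul_of_momentFunctional_nonneg (hk.momentFunctional_nonneg ht hh)

theorem isLogConvexKernel_one_add (hk : IsCompletelyMonotone k)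
    (hk_int : IsLocallyIntegrableKernel k) : IsLogConvexKernel fun t => 1 + k t where
  pos t ht := by linarith [hk.nonneg ht]
  antitoneOn := hk.antitoneOn.const_add 1
  sq_le_mul t h ht hh := by
    have sq_le := hk.sq_le_mul ht hh
    have am_gm : 2 * k (t + h) ≤ k t + k (t + 2 * h) :=
      le_of_sq_le_sq (by nlinarith [sq_nonneg (k t - k (t + 2 * h))])
        (add_nonneg (hk.nonneg ht) (hk.nonneg (by linarith)))
    linarith
  locallyIntegrable R hR := (integrableOn_const (by simp)).add (hk_int R hR)

end IsCompletelyMonotone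

/-! ### Kaluza's theorem -/

/-- The coefficients `b` of the renewal equation `a (n + 1) = ∑_{i + j = n} b i * a j`: the power
series of `a` and `b` satisfy `a(z) - a 0 = z b(z) a(z)`. -/
noncomputable def renewalCoeff (a : ℕ → ℝ) (n : ℕ) : ℝ :=
  PowerSeries.coeff n (PowerSeries.mk (fun n => a (n + 1)) * (PowerSeries.mk a)⁻¹)

theorem sum_renewalCoeff_mul {a : ℕ → ℝ} (ha : a 0 ≠ 0) (n : ℕ) :
    ∑ x ∈ antidiagonal n, renewalCoeff a x.1 * a x.2 = a (n + 1) := by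
  have cancel : PowerSeries.mk (fun n => a (n + 1)) * (PowerSeries.mk a)⁻¹ * PowerSeries.mk a
      = PowerSeries.mk (fun n => a (n + 1)) := by
    rw [mul_assoc, PowerSeries.inv_mul_cancel _ (by simpa using ha), mul_one]
  have := congrArg (PowerSeries.coeff n) cancel
  rw [PowerSeries.coeff_mul] at this
  simpa [renewalCoeff] using this

/-- Kaluza sequences: positive, nonincreasing, log-convex sequences. -/
structure IsKaluzaSeq (a : ℕ → ℝ) : Prop where
  pos : ∀ n, 0 < a n
  antitone : Antitone a
  sq_le_mul : ∀ n, a (n + 1) ^ 2 ≤ a n * a (n + 2)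

namespace IsKaluzaSeq

variable {a : ℕ → ℝ}

theorem monotone_ratio (ha : IsKaluzaSeq a) : Monotone fun n => a (n + 1) / a n := by
  refine monotone_nat_of_le_succ fun n => ?_
  rw [div_le_div_iff₀ (ha.pos _) (ha.pos _), ← sq, mul_comm]
  exact ha.sq_le_mul n

/-- Kaluza's theorem: the ratios `a (j + 1) / a j` increase, so the first `n + 1` terms of the
renewal equation for `a (n + 2)` contribute at most `a (n + 2) / a (n + 1)` times `a (n + 1)`. -/
theorem renewalCoeff_nonneg (ha : IsKaluzaSeq a) (n : ℕ) : 0 ≤ renewalCoeff a n := by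
  induction n using Nat.strong_induction_on with
  | _ n ih =>
  have renewal := sum_renewalCoeff_mul (ha.pos 0).ne' n
  refine nonneg_of_mul_nonneg_left ?_ (ha.pos 0)
  cases n with
  | zero =>
    rw [Finset.Nat.antidiagonal_zero, Finset.sum_singleton] at renewal
    exact renewal ▸ (ha.pos 1).le
  | succ n =>
    rw [Finset.Nat.sum_antidiagonal_succ'] at renewal
    have early_terms_le : ∑ x ∈ antidiagonal n, renewalCoeff a x.1 * a (x.2 + 1)
        ≤ a (n + 2) := calc
      _ ≤ ∑ x ∈ antidiagonal n, renewalCoeff a x.1 * a x.2 * (a (n + 2) / a (n + 1)) := by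
        refine Finset.sum_le_sum fun x hx => ?_
        have hx' := mem_antidiagonal.1 hx
        have ratio_le := ha.monotone_ratio (show x.2 ≤ n + 1 by omega)
        rw [mul_assoc]
        refine mul_le_mul_of_nonneg_left ?_ (ih x.1 (by omega))
        rwa [mul_comm, ← div_le_iff₀ (ha.pos _)]
      _ = a (n + 2) := by
        rw [← Finset.sum_mul, sum_renewalCoeff_mul (ha.pos 0).ne',
          mul_div_cancel₀ _ (ha.pos (n + 1)).ne']
    linarith

theorem sum_range_renewalCoeff_le_one (ha : IsKaluzaSeq a) (n : ℕ) :
    ∑ i ∈ Finset.range n, renewalCoeff a i ≤ 1 := by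
  cases n with
  | zero => simp
  | succ n =>
    refine le_of_mul_le_mul_right ?_ (ha.pos n)
    calc (∑ i ∈ Finset.range (n + 1), renewalCoeff a i) * a n
        = ∑ i ∈ Finset.range (n + 1), renewalCoeff a i * a n := Finset.sum_mul ..
      _ ≤ ∑ i ∈ Finset.range (n + 1), renewalCoeff a i * a (n - i) :=
        Finset.sum_le_sum fun i _ =>
          mul_le_mul_of_nonneg_left (ha.antitone (n.sub_le i)) (ha.renewalCoeff_nonneg i)
      _ = a (n + 1) := by
        rw [← sum_renewalCoeff_mul (ha.pos 0).ne' n,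
          Finset.Nat.sum_antidiagonal_eq_sum_range_succ fun i j => renewalCoeff a i * a j]
      _ ≤ 1 * a n := by simpa using ha.antitone n.le_succ

theorem summable_mul_pow (ha : IsKaluzaSeq a) {z : ℝ} (hz : 0 < z) (hz1 : z < 1) :
    Summable fun n => a n * z ^ n :=
  .of_nonneg_of_le (fun n => mul_nonneg (ha.pos n).le (by positivity))
    (fun n => mul_le_mul_of_nonneg_right (ha.antitone n.zero_le) (by positivity))
    ((summable_geometric_of_lt_one hz.le hz1).mul_left (a 0))

theorem tsum_mul_pow_pos (ha : IsKaluzaSeq a) {z : ℝ} (hz : 0 < z) (hz1 : z < 1) :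
    0 < ∑' n, a n * z ^ n :=
  (ha.summable_mul_pow hz hz1).tsum_pos (fun n => mul_nonneg (ha.pos n).le (by positivity)) 0
    (by simpa using ha.pos 0)

theorem summable_renewalCoeff (ha : IsKaluzaSeq a) : Summable (renewalCoeff a) :=
  summable_of_sum_range_le ha.renewalCoeff_nonneg ha.sum_range_renewalCoeff_le_one

theorem hasSum_renewalCoeff_mul_pow (ha : IsKaluzaSeq a) {z : ℝ} (hz : 0 < z) (hz1 : z < 1) :
    HasSum (fun n => renewalCoeff a n * z ^ (n + 1)) (1 - a 0 / ∑' n, a n * z ^ n) := by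
  have summable_b : Summable fun n => renewalCoeff a n * z ^ (n + 1) :=
    .of_nonneg_of_le (fun n => mul_nonneg (ha.renewalCoeff_nonneg n) (by positivity))
      (fun n => mul_le_of_le_one_right (ha.renewalCoeff_nonneg n) (pow_le_one₀ hz.le hz1.le))
      ha.summable_renewalCoeff
  have summable_a := ha.summable_mul_pow hz hz1
  have cauchy_product (n : ℕ) : ∑ x ∈ antidiagonal n,
      renewalCoeff a x.1 * z ^ (x.1 + 1) * (a x.2 * z ^ x.2) = a (n + 1) * z ^ (n + 1) := by
    rw [← sum_renewalCoeff_mul (ha.pos 0).ne' n, Finset.sum_mul]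
    refine Finset.sum_congr rfl fun x hx => ?_
    rw [← mem_antidiagonal.1 hx]
    ring
  have product := tsum_mul_tsum_eq_tsum_sum_antidiagonal_of_summable_norm
    summable_b.norm summable_a.norm
  have split := summable_a.tsum_eq_zero_add
  simp only [cauchy_product] at product
  rw [pow_zero, mul_one, ← product] at split
  have tsum_eq : ∑' n, renewalCoeff a n * z ^ (n + 1) = 1 - a 0 / ∑' n, a n * z ^ n := by
    rw [eq_sub_iff_add_eq, ← eq_sub_iff_add_eq', div_eq_iff (ha.tsum_mul_pow_pos hz hz1).ne']
    linarith
  exact tsum_eq ▸ summable_b.hasSum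

end IsKaluzaSeq

/-! ### Laplace transforms of laws on `[0, ∞]` -/

/-- `F(λ) = ∫ x^λ dμ(x)` for `λ > 0`. In the variable `x = e^{-t}` this says that `F` is the Laplace
transform of a measure on `[0, ∞]`; mass at `t = ∞`, that is, at `x = 0`, does not contribute. -/
def HasPowerTransform (μ : Measure I) (F : ℝ → ℝ) : Prop :=
  ∀ lam : ℝ, 0 < lam → ∫ x : I, (x : ℝ) ^ lam ∂μ = F lam

/-- `F` is the Laplace transform of a probability measure on `[0, ∞]`. On the compact space `[0, ∞]`
no tightness is needed to pass to limits. -/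
def IsPowerTransform (F : ℝ → ℝ) : Prop :=
  ∃ μ : ProbabilityMeasure I, HasPowerTransform (μ : Measure I) F

theorem continuous_rpow_unitInterval {lam : ℝ} (h : 0 < lam) :
    Continuous fun x : I => (x : ℝ) ^ lam :=
  continuous_subtype_val.rpow_const fun _ => Or.inr h.le

theorem integrable_rpow_unitInterval {lam : ℝ} (h : 0 < lam) (μ : Measure I)
    [IsFiniteMeasure μ] : Integrable (fun x : I => (x : ℝ) ^ lam) μ :=
  (continuous_rpow_unitInterval h).integrable_of_hasCompactSupport
    (HasCompactSupport.of_compactSpace _)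

theorem HasPowerTransform.mconv {μ ν : Measure I} [SFinite μ] [SFinite ν] {F G : ℝ → ℝ}
    (hF : HasPowerTransform μ F) (hG : HasPowerTransform ν G) :
    HasPowerTransform (μ ∗ₘ ν) fun lam => F lam * G lam := by
  intro lam hlam
  beta_reduce
  rw [Measure.mconv, integral_map (by fun_prop)
    (continuous_rpow_unitInterval hlam).aestronglyMeasurable, ← hF lam hlam, ← hG lam hlam,
    ← integral_prod_mul]
  exact integral_congr_ae (.of_forall fun x => Real.mul_rpow x.1.2.1 x.2.2.1)

namespace IsPowerTransform

variable {F G : ℝ → ℝ}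

theorem exp_neg_mul {s : ℝ} (hs : 0 ≤ s) : IsPowerTransform fun lam => Real.exp (-(lam * s)) := by
  refine ⟨⟨Measure.dirac ⟨Real.exp (-s), (Real.exp_pos _).le, Real.exp_le_one_iff.2 (by linarith)⟩,
    inferInstance⟩, fun lam _ => ?_⟩
  rw [ProbabilityMeasure.coe_mk, integral_dirac, ← Real.exp_mul, neg_mul, mul_comm]

theorem one : IsPowerTransform fun _ => 1 := by
  simpa using exp_neg_mul le_rfl

theorem mul (hF : IsPowerTransform F) (hG : IsPowerTransform G) :
    IsPowerTransform fun lam => F lam * G lam := by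
  obtain ⟨μ, hμ⟩ := hF
  obtain ⟨ν, hν⟩ := hG
  exact ⟨⟨μ ∗ₘ ν, inferInstance⟩, hμ.mconv hν⟩

theorem pow (hF : IsPowerTransform F) (n : ℕ) : IsPowerTransform fun lam => F lam ^ n := by
  induction n with
  | zero => simpa using one
  | succ n ih => simpa only [pow_succ] using ih.mul hF

/-- The missing mass `1 - ∑ c i` is put at `x = 0`. -/
theorem finset_sum {ι : Type*} (s : Finset ι) {c : ι → ℝ} {F : ι → ℝ → ℝ}
    (hc : ∀ i, 0 ≤ c i) (hs : ∑ i ∈ s, c i ≤ 1) (hF : ∀ i, IsPowerTransform (F i)) :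
    IsPowerTransform fun lam => ∑ i ∈ s, c i * F i lam := by
  choose μ hμ using hF
  set ν : Measure I := ∑ i ∈ s, ENNReal.ofReal (c i) • (μ i : Measure I)
    + ENNReal.ofReal (1 - ∑ i ∈ s, c i) • Measure.dirac 0 with hν
  have isProbabilityMeasure : IsProbabilityMeasure ν := by
    constructor
    simp only [hν, Measure.coe_add, Measure.coe_finsetSum, Measure.coe_smul, Pi.add_apply,
      Finset.sum_apply, Pi.smul_apply, measure_univ, smul_eq_mul, mul_one]
    rw [← ENNReal.ofReal_sum_of_nonneg fun i _ => hc i, ← ENNReal.ofReal_add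
      (Finset.sum_nonneg fun i _ => hc i) (by linarith), add_sub_cancel, ENNReal.ofReal_one]
  refine ⟨⟨ν, isProbabilityMeasure⟩, fun lam hlam => ?_⟩
  have integrable (ρ : Measure I) [IsFiniteMeasure ρ] (r : ℝ) :
      Integrable (fun x : I => (x : ℝ) ^ lam) (ENNReal.ofReal r • ρ) :=
    (integrable_rpow_unitInterval hlam _).smul_measure ENNReal.ofReal_ne_top
  rw [ProbabilityMeasure.coe_mk, hν, integral_add_measure
    (integrable_finsetSum_measure.2 fun i _ => integrable (μ i) (c i))
    (integrable (Measure.dirac 0) _),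
    integral_finsetSum_measure fun i _ => integrable (μ i) (c i)]
  simp only [integral_smul_measure, integral_dirac, hμ _ lam hlam, Set.Icc.coe_zero,
    Real.zero_rpow hlam.ne', smul_eq_mul, mul_zero, add_zero, ENNReal.toReal_ofReal (hc _)]

theorem convex_combination (hF : IsPowerTransform F) (hG : IsPowerTransform G) {c : ℝ}
    (hc : 0 ≤ c) (hc1 : c ≤ 1) : IsPowerTransform fun lam => (1 - c) * F lam + c * G lam := by
  have nonneg : ∀ i, 0 ≤ ![1 - c, c] i := by simp [Fin.forall_fin_two, hc, hc1]
  have isPowerTransform : ∀ i, IsPowerTransform (![F, G] i) := by simp [Fin.forall_fin_two, hF, hG]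
  simpa [Fin.sum_univ_two] using finset_sum Finset.univ nonneg (by simp) isPowerTransform

theorem of_tendsto {ι : Type*} {l : Filter ι} [l.NeBot] {F : ι → ℝ → ℝ}
    (hF : ∀ᶠ i in l, IsPowerTransform (F i))
    (h : ∀ lam, 0 < lam → Tendsto (fun i => F i lam) l (𝓝 (G lam))) : IsPowerTransform G := by
  have exists_law (i : ι) : ∃ μ : ProbabilityMeasure I,
      IsPowerTransform (F i) → HasPowerTransform (μ : Measure I) (F i) := by
    by_cases hi : IsPowerTransform (F i)
    · exact hi.imp fun μ hμ _ => hμ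
    · exact ⟨⟨Measure.dirac 0, inferInstance⟩, fun h => absurd h hi⟩
  choose μ hμ using exists_law
  let U := Ultrafilter.of l
  have tendsto_law : Tendsto μ U (𝓝 (U.map μ).lim) := Ultrafilter.le_nhds_lim (U.map μ)
  refine ⟨(U.map μ).lim, fun lam hlam => tendsto_nhds_unique
    ((ProbabilityMeasure.tendsto_iff_forall_integral_tendsto.1 tendsto_law)
      (.mkOfCompact ⟨_, continuous_rpow_unitInterval hlam⟩)) ?_⟩
  refine ((h lam hlam).mono_left (Ultrafilter.of_le l)).congr' ?_
  filter_upwards [hF.filter_mono (Ultrafilter.of_le l)] with i hi using (hμ i hi lam hlam).symm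

theorem of_hasSum {c : ℕ → ℝ} {F : ℕ → ℝ → ℝ} (hc : ∀ i, 0 ≤ c i)
    (hs : ∀ N, ∑ i ∈ Finset.range N, c i ≤ 1) (hF : ∀ i, IsPowerTransform (F i))
    (hG : ∀ lam, 0 < lam → HasSum (fun i => c i * F i lam) (G lam)) : IsPowerTransform G :=
  .of_tendsto (.of_forall fun N => .finset_sum (Finset.range N) hc (hs N) hF)
    fun lam hlam => (hG lam hlam).tendsto_sum_nat

/-- `e^{-τφ}` is the limit of `(1 - τφ/n)^n`. -/
theorem exp_of_one_sub {φ : ℝ → ℝ} {c₀ : ℝ} (hc₀ : 0 < c₀)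
    (h : ∀ c, 0 ≤ c → c ≤ c₀ → IsPowerTransform fun lam => 1 - c * φ lam) {τ : ℝ} (hτ : 0 ≤ τ) :
    IsPowerTransform fun lam => Real.exp (-(τ * φ lam)) := by
  have eventually_le : ∀ᶠ n : ℕ in atTop, τ / (n : ℝ) ≤ c₀ :=
    (tendsto_const_div_atTop_nhds_zero_nat τ).eventually_le_const hc₀
  refine .of_tendsto (l := atTop) (F := fun (n : ℕ) lam => (1 - τ / n * φ lam) ^ n) ?_ ?_
  · filter_upwards [eventually_le] with n hn using (h _ (by positivity) hn).pow n
  · refine fun lam _ => (Real.tendsto_one_add_div_pow_exp (-(τ * φ lam))).congr fun n => ?_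
    congr 1
    ring

end IsPowerTransform

namespace IsKaluzaSeq

variable {a : ℕ → ℝ} {h : ℝ}

theorem isPowerTransform_one_sub_div_tsum (ha : IsKaluzaSeq a) (hh : 0 < h) :
    IsPowerTransform fun lam => 1 - a 0 / ∑' n, a n * Real.exp (-(lam * h)) ^ n := by
  refine .of_hasSum (F := fun n lam => Real.exp (-(lam * ((n + 1 : ℕ) * h))))
    ha.renewalCoeff_nonneg ha.sum_range_renewalCoeff_le_one (fun n => .exp_neg_mul (by positivity))
    fun lam hlam => ?_
  have exp_lt_one : Real.exp (-(lam * h)) < 1 :=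
    Real.exp_lt_one_iff.2 (neg_lt_zero.2 (mul_pos hlam hh))
  convert ha.hasSum_renewalCoeff_mul_pow (Real.exp_pos _) exp_lt_one using 3 with n
  rw [← Real.exp_nat_mul]
  ring_nf

theorem isPowerTransform_exp_neg_div_tsum (ha : IsKaluzaSeq a) (hh : 0 < h) {τ : ℝ} (hτ : 0 ≤ τ) :
    IsPowerTransform fun lam =>
      Real.exp (-(τ * (1 / ∑' n, a n * Real.exp (-(lam * h)) ^ n))) := by
  refine .exp_of_one_sub (ha.pos 0) (fun c hc hca => ?_) hτ
  have a_zero_ne := (ha.pos 0).ne'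
  convert IsPowerTransform.one.convex_combination (ha.isPowerTransform_one_sub_div_tsum hh)
    (div_nonneg hc (ha.pos 0).le) ((div_le_one (ha.pos 0)).2 hca) using 2 with lam
  field_simp
  ring

end IsKaluzaSeq

section RiemannSum

variable {g : ℝ → ℝ} {h : ℝ}

theorem hasSum_integral_cell (hg : IntegrableOn g (Ioi 0)) (hh : 0 < h) :
    HasSum (fun n : ℕ => ∫ t in Ioc (n * h) ((n + 1) * h), g t) (∫ t in Ioi 0, g t) := by
  have hmono : Monotone fun n : ℕ => (n : ℝ) * h := fun i j hij =>
    mul_le_mul_of_nonneg_right (Nat.cast_le.2 hij) hh.le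
  have hcover : ⋃ n : ℕ, Ioc (n * h) ((n + 1) * h) = Ioi (0 : ℝ) := by
    simpa using iUnion_Ioc_map_succ_eq_Ioi (f := fun n : ℕ => (n : ℝ) * h)
      (fun n => by simpa using mul_nonneg n.cast_nonneg hh.le)
      (not_bddAbove_of_tendsto_atTop (tendsto_natCast_atTop_atTop.atTop_mul_const hh))
  rw [← hcover] at hg ⊢
  exact hasSum_integral_iUnion (fun n => measurableSet_Ioc)
    (by simpa using hmono.pairwise_disjoint_on_Ioc_succ) hg

theorem mul_le_integral_cell (hg : IntegrableOn g (Ioi 0)) (hg_anti : AntitoneOn g (Ioi 0))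
    (hh : 0 < h) (n : ℕ) :
    h * g ((n + 1) * h) ≤ ∫ t in Ioc (n * h) ((n + 1) * h), g t := by
  have hn : 0 ≤ n * h := by positivity
  have hle := setIntegral_mono_on (integrableOn_const (by simp))
    (hg.mono_set fun t ht => hn.trans_lt ht.1) measurableSet_Ioc
    fun t (ht : t ∈ Ioc (n * h) ((n + 1) * h)) =>
      hg_anti (hn.trans_lt ht.1) (mem_Ioi.2 (by positivity)) ht.2
  have hlen : (n + 1) * h - n * h = h := by ring
  simpa [hlen, hh.le] using hle

theorem integral_cell_succ_le_mul (hg : IntegrableOn g (Ioi 0)) (hg_anti : AntitoneOn g (Ioi 0))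
    (hh : 0 < h) (n : ℕ) :
    ∫ t in Ioc ((n + 1) * h) ((n + 1 + 1) * h), g t ≤ h * g ((n + 1) * h) := by
  have hn : 0 < (n + 1) * h := by positivity
  have hle := setIntegral_mono_on (hg.mono_set fun t ht => hn.trans ht.1)
    (integrableOn_const (by simp)) measurableSet_Ioc
    fun t (ht : t ∈ Ioc ((n + 1) * h) ((n + 1 + 1) * h)) => hg_anti hn (hn.trans ht.1) ht.1.le
  have hlen : (n + 1 + 1) * h - (n + 1) * h = h := by ring
  simpa [hlen, hh.le] using hle

theorem tendsto_riemannSum_Ioi (hg : IntegrableOn g (Ioi 0)) (hg_anti : AntitoneOn g (Ioi 0))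
    (hg_nonneg : ∀ t, 0 < t → 0 ≤ g t) :
    Tendsto (fun h => ∑' n : ℕ, h * g ((n + 1) * h)) (𝓝[>] 0) (𝓝 (∫ t in Ioi 0, g t)) := by
  have hcell_zero : Tendsto (fun h => ∫ t in Ioc 0 h, g t) (𝓝[>] 0) (𝓝 0) := by
    have hcont := intervalIntegral.continuousOn_primitive (a := 0) (b := 1) (f := g)
      ((hg.mono_set Ioc_subset_Ioi_self).congr_set_ae Ioc_ae_eq_Icc.symm)
    have hlim := hcont 0 (by simp)
    rw [ContinuousWithinAt, Ioc_self, Measure.restrict_empty, integral_zero_measure] at hlim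
    exact hlim.mono_left (nhdsWithin_le_of_mem
      (mem_of_superset (Ioc_mem_nhdsGT one_pos) Ioc_subset_Icc_self))
  have hlower : Tendsto (fun h => (∫ t in Ioi 0, g t) - ∫ t in Ioc 0 h, g t) (𝓝[>] 0)
      (𝓝 (∫ t in Ioi 0, g t)) := by
    simpa using hcell_zero.const_sub (∫ t in Ioi 0, g t)
  have hbounds : ∀ h > 0, (∫ t in Ioi 0, g t) - ∫ t in Ioc 0 h, g t ≤ ∑' n : ℕ, h * g ((n + 1) * h)
      ∧ ∑' n : ℕ, h * g ((n + 1) * h) ≤ ∫ t in Ioi 0, g t := by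
    intro h hh
    have hcells := hasSum_integral_cell hg hh
    have hsum : Summable fun n : ℕ => h * g ((n + 1) * h) :=
      hcells.summable.of_nonneg_of_le
        (fun n => mul_nonneg hh.le (hg_nonneg _ (by positivity)))
        (mul_le_integral_cell hg hg_anti hh)
    have htail := (hasSum_nat_add_iff' 1).2 hcells
    simp only [Finset.sum_range_one, Nat.cast_add, Nat.cast_one, Nat.cast_zero, zero_mul, zero_add,
      one_mul] at htail
    exact ⟨hasSum_le (integral_cell_succ_le_mul hg hg_anti hh) htail hsum.hasSum,
      hasSum_le (mul_le_integral_cell hg hg_anti hh) hsum.hasSum hcells⟩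
  refine tendsto_of_tendsto_of_tendsto_of_le_of_le' hlower tendsto_const_nhds ?_ ?_
  · filter_upwards [self_mem_nhdsWithin] with h hh using (hbounds h hh).1
  · filter_upwards [self_mem_nhdsWithin] with h hh using (hbounds h hh).2

end RiemannSum

theorem integrableOn_exp_neg_mul_Ioi {lam : ℝ} (hlam : 0 < lam) (c : ℝ) :
    IntegrableOn (fun t => Real.exp (-(lam * t))) (Ioi c) := by
  simpa only [neg_mul] using exp_neg_integrableOn_Ioi c hlam

namespace IsLogConvexKernel

variable {m : ℝ → ℝ} {lam : ℝ}

theorem antitoneOn_exp_mul (hm : IsLogConvexKernel m) (hlam : 0 < lam) :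
    AntitoneOn (fun t => Real.exp (-(lam * t)) * m t) (Ioi 0) :=
  fun s hs t ht hst => mul_le_mul (by gcongr) (hm.antitoneOn hs ht hst) (hm.pos t ht).le
    (Real.exp_nonneg _)

theorem integrableOn_laplace (hm : IsLogConvexKernel m) (hlam : 0 < lam) :
    IntegrableOn (fun t => Real.exp (-(lam * t)) * m t) (Ioi 0) := by
  have hmeas : AEStronglyMeasurable (fun t => Real.exp (-(lam * t)) * m t)
      (volume.restrict (Ioi 0)) :=
    (aemeasurable_restrict_of_antitoneOn measurableSet_Ioi
      (hm.antitoneOn_exp_mul hlam)).aestronglyMeasurable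
  have hbound : ∀ s : Set ℝ, MeasurableSet s → s ⊆ Ioi 0 → ∀ G : ℝ → ℝ, IntegrableOn G s →
      (∀ t ∈ s, Real.exp (-(lam * t)) * m t ≤ G t) →
      IntegrableOn (fun t => Real.exp (-(lam * t)) * m t) s := by
    intro s hs hs_sub G hG hle
    refine Integrable.mono' hG (hmeas.mono_set hs_sub) ((ae_restrict_mem hs).mono fun t ht => ?_)
    rw [Real.norm_of_nonneg (mul_nonneg (Real.exp_nonneg _) (hm.pos t (hs_sub ht)).le)]
    exact hle t ht
  rw [← Ioc_union_Ioi_eq_Ioi zero_le_one]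
  refine (hbound _ measurableSet_Ioc Ioc_subset_Ioi_self m (hm.locallyIntegrable 1 one_pos)
    fun t ht => ?_).union (hbound _ measurableSet_Ioi (Ioi_subset_Ioi zero_le_one)
      (fun t => Real.exp (-(lam * t)) * m 1)
      ((integrableOn_exp_neg_mul_Ioi hlam 1).mul_const _) fun t ht => ?_)
  · have hexp : Real.exp (-(lam * t)) ≤ 1 :=
      Real.exp_le_one_iff.2 (neg_nonpos.2 (mul_nonneg hlam.le ht.1.le))
    exact mul_le_of_le_one_left (hm.pos t ht.1).le hexp
  · exact mul_le_mul_of_nonneg_left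
      (hm.antitoneOn (mem_Ioi.2 one_pos) (mem_Ioi.2 (one_pos.trans ht)) (le_of_lt ht))
      (Real.exp_nonneg _)

theorem laplace_pos (hm : IsLogConvexKernel m) (hlam : 0 < lam) : 0 < laplace m lam := by
  have hpos : ∀ t ∈ Ioi (0 : ℝ), 0 < Real.exp (-(lam * t)) * m t := fun t ht =>
    mul_pos (Real.exp_pos _) (hm.pos t ht)
  have hsupport : Ioi 0 ⊆ Function.support fun t => Real.exp (-(lam * t)) * m t :=
    fun t ht => (hpos t ht).ne'
  rw [laplace, setIntegral_pos_iff_support_of_nonneg_ae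
    ((ae_restrict_mem measurableSet_Ioi).mono fun t ht => (hpos t ht).le)
    (hm.integrableOn_laplace hlam), inter_eq_right.2 hsupport, Real.volume_Ioi]
  exact ENNReal.zero_lt_top

theorem isKaluzaSeq_sample (hm : IsLogConvexKernel m) {h : ℝ} (hh : 0 < h) :
    IsKaluzaSeq fun n => h * m ((n + 1) * h) where
  pos n := mul_pos hh (hm.pos _ (by positivity))
  antitone := antitone_nat_of_succ_le fun n => mul_le_mul_of_nonneg_left
    (hm.antitoneOn (mem_Ioi.2 (by positivity)) (mem_Ioi.2 (by positivity))
      (by push_cast; linarith)) hh.le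
  sq_le_mul n := by
    have hconv := hm.sq_le_mul ((n + 1) * h) h (by positivity) hh.le
    rw [show (n + 1) * h + h = (n + 1 + 1) * h by ring,
      show (n + 1) * h + 2 * h = (n + 2 + 1) * h by ring] at hconv
    push_cast
    nlinarith [sq_nonneg h]

theorem tendsto_tsum_sample (hm : IsLogConvexKernel m) (hlam : 0 < lam) :
    Tendsto (fun h => ∑' n : ℕ, h * m ((n + 1) * h) * Real.exp (-(lam * h)) ^ n) (𝓝[>] 0)
      (𝓝 (laplace m lam)) := by
  have hfactor : Tendsto (fun h => Real.exp (lam * h)) (𝓝[>] 0) (𝓝 1) := by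
    have hcont : Continuous fun h => Real.exp (lam * h) := by fun_prop
    simpa using (hcont.tendsto 0).mono_left (nhdsWithin_le_nhds (s := Ioi 0))
  have hriemann := tendsto_riemannSum_Ioi (hm.integrableOn_laplace hlam)
    (hm.antitoneOn_exp_mul hlam) fun t ht => mul_nonneg (Real.exp_nonneg _) (hm.pos t ht).le
  refine (one_mul (laplace m lam) ▸ hfactor.mul hriemann).congr fun h => ?_
  rw [← tsum_mul_left]
  refine tsum_congr fun n => ?_
  have hexp : Real.exp (-(lam * h)) ^ n
      = Real.exp (lam * h) * Real.exp (-(lam * ((n + 1) * h))) := by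
    rw [← Real.exp_nat_mul, ← Real.exp_add]
    ring_nf
  rw [hexp]
  ring

theorem isPowerTransform_exp_laplaceExponent (hm : IsLogConvexKernel m) {τ : ℝ} (hτ : 0 ≤ τ) :
    IsPowerTransform fun lam => Real.exp (-(τ * laplaceExponent m lam)) := by
  refine .of_tendsto (l := 𝓝[>] (0 : ℝ))
    (eventually_mem_nhdsWithin.mono fun h hh =>
      (hm.isKaluzaSeq_sample hh).isPowerTransform_exp_neg_div_tsum hh hτ) fun lam hlam => ?_
  have hlim := (hm.tendsto_tsum_sample hlam).inv₀ (hm.laplace_pos hlam).ne'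
  simp only [laplaceExponent, one_div]
  exact (Real.continuous_exp.tendsto _).comp (hlim.const_mul τ).neg

end IsLogConvexKernel

/-! ### Uniqueness of the Laplace transform -/

theorem continuous_integral_continuousMap {α : Type*} [TopologicalSpace α] [CompactSpace α]
    [MeasurableSpace α] [BorelSpace α] (μ : Measure α) [IsFiniteMeasure μ] :
    Continuous fun g : C(α, ℝ) => ∫ x, g x ∂μ := by
  refine ((continuous_integral (μ := μ) (G := ℝ)).comp
    (ContinuousMap.toLp (E := ℝ) 1 μ ℝ).continuous).congr fun g => ?_
  exact integral_congr_ae (ContinuousMap.coeFn_toLp μ g)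

theorem ext_of_moments {s : Set ℝ} [CompactSpace s] {μ ν : Measure s} [IsFiniteMeasure μ]
    [IsFiniteMeasure ν] (h : ∀ n : ℕ, ∫ x : s, (x : ℝ) ^ n ∂μ = ∫ x : s, (x : ℝ) ^ n ∂ν) :
    μ = ν := by
  have hint (ρ : Measure s) [IsFiniteMeasure ρ] (g : C(s, ℝ)) : Integrable g ρ :=
    g.continuous.integrable_of_hasCompactSupport (HasCompactSupport.of_compactSpace _)
  have hclosed : IsClosed {g : C(s, ℝ) | ∫ x, g x ∂μ = ∫ x, g x ∂ν} :=
    isClosed_eq (continuous_integral_continuousMap μ) (continuous_integral_continuousMap ν)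
  have hpoly (q : ℝ[X]) : ∫ x, q.toContinuousMapOn s x ∂μ = ∫ x, q.toContinuousMapOn s x ∂ν := by
    induction q using Polynomial.induction_on' with
    | add p q hp hq =>
      have hadd : (p + q).toContinuousMapOn s = p.toContinuousMapOn s + q.toContinuousMapOn s := by
        ext; simp
      simp only [hadd, ContinuousMap.add_apply]
      rw [integral_add (hint _ _) (hint _ _), integral_add (hint _ _) (hint _ _), hp, hq]
    | monomial n c => simp [integral_const_mul, h n]
  refine ext_of_forall_integral_eq_of_IsFiniteMeasure fun f => ?_
  have hmem : f.toContinuousMap ∈ (polynomialFunctions s).topologicalClosure := by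
    rw [polynomialFunctions.topologicalClosure]
    exact Algebra.mem_top
  refine closure_minimal ?_ hclosed hmem
  rintro _ ⟨q, -, rfl⟩
  exact hpoly q

theorem HasPowerTransform.unique {μ ν : Measure I} [IsProbabilityMeasure μ]
    [IsProbabilityMeasure ν] {F : ℝ → ℝ} (hμ : HasPowerTransform μ F)
    (hν : HasPowerTransform ν F) : μ = ν := by
  refine ext_of_moments fun n => ?_
  rcases n.eq_zero_or_pos with rfl | hn
  · simp
  · simp only [← Real.rpow_natCast]
    rw [hμ n (Nat.cast_pos.2 hn), hν n (Nat.cast_pos.2 hn)]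

/-- The parametrization `t ↦ e^{-t}` of the unit interval by `[0, ∞]`; negative `t` are mapped
to `1`. -/
noncomputable def expNeg (t : ℝ) : I :=
  ⟨Real.exp (-max t 0), (Real.exp_pos _).le, Real.exp_le_one_iff.2 (by simp)⟩

theorem measurable_expNeg : Measurable expNeg :=
  Measurable.subtype_mk (by fun_prop)

theorem coe_expNeg {t : ℝ} (ht : 0 ≤ t) : (expNeg t : ℝ) = Real.exp (-t) := by
  simp only [expNeg, max_eq_left ht]

theorem map_neg_log_map_expNeg {μ : Measure ℝ} (hμ : ∀ᵐ t ∂μ, 0 ≤ t) :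
    (μ.map expNeg).map (fun x : I => -Real.log x) = μ := by
  rw [Measure.map_map (by fun_prop) measurable_expNeg]
  conv_rhs => rw [← Measure.map_id (μ := μ)]
  refine Measure.map_congr (hμ.mono fun t ht => ?_)
  simp [coe_expNeg ht]

theorem ext_of_integral_exp_neg_nat_mul {μ ν : Measure ℝ} [IsFiniteMeasure μ] [IsFiniteMeasure ν]
    (hμ : ∀ᵐ t ∂μ, 0 ≤ t) (hν : ∀ᵐ t ∂ν, 0 ≤ t)
    (h : ∀ n : ℕ, ∫ t, Real.exp (-(n * t)) ∂μ = ∫ t, Real.exp (-(n * t)) ∂ν) : μ = ν := by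
  have hmoment {ρ : Measure ℝ} (hρ : ∀ᵐ t ∂ρ, 0 ≤ t) (n : ℕ) :
      ∫ x : I, (x : ℝ) ^ n ∂(ρ.map expNeg) = ∫ t, Real.exp (-(n * t)) ∂ρ := by
    rw [integral_map measurable_expNeg.aemeasurable (by fun_prop)]
    refine integral_congr_ae (hρ.mono fun t ht => ?_)
    simp only [coe_expNeg ht, ← Real.exp_nat_mul, mul_neg]
  rw [← map_neg_log_map_expNeg hμ, ← map_neg_log_map_expNeg hν,
    ext_of_moments fun n => (hmoment hμ n).trans ((h n).trans (hmoment hν n).symm)]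

/-- The finite measure `e^{-t} g(t) dt` on `(0, ∞)`, whose moments in the variable `e^{-t}` are
values of the Laplace transform of `g`. -/
noncomputable def expDensityMeasure (g : ℝ → ℝ) : Measure ℝ :=
  (volume.restrict (Ioi 0)).withDensity fun t => ENNReal.ofReal (Real.exp (-t) * g t)

theorem ae_expDensityMeasure_nonneg (g : ℝ → ℝ) : ∀ᵐ t ∂(expDensityMeasure g), 0 ≤ t :=
  (withDensity_absolutelyContinuous _ _).ae_le
    ((ae_restrict_mem measurableSet_Ioi).mono fun _ ht => le_of_lt ht)

theorem integral_exp_expDensityMeasure {g : ℝ → ℝ} (hg : ∀ t, 0 < t → 0 ≤ g t)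
    (hg_int : IntegrableOn (fun t => Real.exp (-t) * g t) (Ioi 0)) (lam : ℝ) :
    ∫ t, Real.exp (-(lam * t)) ∂(expDensityMeasure g) = laplace g (lam + 1) := by
  rw [expDensityMeasure, integral_withDensity_eq_integral_toReal_smul₀
    hg_int.1.aemeasurable.ennreal_ofReal (by simp), laplace]
  refine setIntegral_congr_fun measurableSet_Ioi fun t ht => ?_
  rw [ENNReal.toReal_ofReal (mul_nonneg (Real.exp_nonneg _) (hg t ht)), smul_eq_mul,
    mul_right_comm, ← Real.exp_add]
  ring_nf

theorem ae_eq_of_laplace_eq {g₁ g₂ : ℝ → ℝ} (hg₁ : ∀ t, 0 < t → 0 ≤ g₁ t)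
    (hg₂ : ∀ t, 0 < t → 0 ≤ g₂ t)
    (hint₁ : IntegrableOn (fun t => Real.exp (-t) * g₁ t) (Ioi 0))
    (hint₂ : IntegrableOn (fun t => Real.exp (-t) * g₂ t) (Ioi 0))
    (h : ∀ lam, 0 < lam → laplace g₁ lam = laplace g₂ lam) :
    ∀ᵐ t ∂(volume.restrict (Ioi (0 : ℝ))), g₁ t = g₂ t := by
  have hfin₁ : IsFiniteMeasure (expDensityMeasure g₁) := isFiniteMeasure_withDensity_ofReal hint₁.2
  have hfin₂ : IsFiniteMeasure (expDensityMeasure g₂) := isFiniteMeasure_withDensity_ofReal hint₂.2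
  have heq : expDensityMeasure g₁ = expDensityMeasure g₂ :=
    ext_of_integral_exp_neg_nat_mul (ae_expDensityMeasure_nonneg g₁)
      (ae_expDensityMeasure_nonneg g₂) fun n => by
        rw [integral_exp_expDensityMeasure hg₁ hint₁, integral_exp_expDensityMeasure hg₂ hint₂,
          h _ (by positivity)]
  have hdensity := (withDensity_eq_iff_of_sigmaFinite hint₁.1.aemeasurable.ennreal_ofReal
    hint₂.1.aemeasurable.ennreal_ofReal).1 heq
  filter_upwards [hdensity, ae_restrict_mem measurableSet_Ioi] with t ht ht_pos
  rw [ENNReal.ofReal_eq_ofReal_iff (mul_nonneg (Real.exp_nonneg _) (hg₁ t ht_pos))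
    (mul_nonneg (Real.exp_nonneg _) (hg₂ t ht_pos))] at ht
  exact mul_left_cancel₀ (Real.exp_ne_zero _) ht

theorem eq_of_ae_eq_of_continuousWithinAt_Iic {Y : Type*} [TopologicalSpace Y] [T2Space Y]
    {g₁ g₂ : ℝ → Y} {a t : ℝ} (hat : a < t) (h : ∀ᵐ s ∂(volume.restrict (Ioi a)), g₁ s = g₂ s)
    (h₁ : ContinuousWithinAt g₁ (Iic t) t) (h₂ : ContinuousWithinAt g₂ (Iic t) t) :
    g₁ t = g₂ t := by
  have hdense := Measure.dense_of_ae ((ae_restrict_iff' measurableSet_Ioi).1 h)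
  have hmem : t ∈ closure (Ioo a t ∩ {s | s ∈ Ioi a → g₁ s = g₂ s}) := by
    refine closure_minimal (hdense.open_subset_closure_inter isOpen_Ioo) isClosed_closure ?_
    rw [closure_Ioo hat.ne]
    exact right_mem_Icc.2 hat.le
  refine tendsto_nhds_unique_of_frequently_eq h₁ h₂ (frequently_nhdsWithin_iff.2 ?_)
  exact (mem_closure_iff_frequently.1 hmem).mono fun s hs => ⟨hs.2 hs.1.1, hs.1.2.le⟩

namespace IsPropagationFunction

variable {m : ℝ → ℝ} {w w₁ w₂ : ℝ → ℝ → ℝ}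

theorem nonneg (hw : IsPropagationFunction m w) {t τ : ℝ} (ht : 0 ≤ t) (hτ : 0 ≤ τ) :
    0 ≤ w t τ := by
  obtain ⟨hmono, hzero, -⟩ := hw τ hτ
  exact hzero ▸ hmono self_mem_Ici ht ht

theorem unique (h₁ : IsPropagationFunction m w₁) (h₂ : IsPropagationFunction m w₂) {t τ : ℝ}
    (ht : 0 ≤ t) (hτ : 0 ≤ τ) : w₁ t τ = w₂ t τ := by
  obtain ⟨-, hzero₁, hcont₁, hlaplace₁⟩ := h₁ τ hτ
  obtain ⟨-, hzero₂, hcont₂, hlaplace₂⟩ := h₂ τ hτ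
  rcases ht.eq_or_lt with rfl | ht
  · rw [hzero₁, hzero₂]
  have hae := ae_eq_of_laplace_eq (fun t ht => h₁.nonneg ht.le hτ) (fun t ht => h₂.nonneg ht.le hτ)
    (by simpa using (hlaplace₁ 1 one_pos).1) (by simpa using (hlaplace₂ 1 one_pos).1)
    fun lam hlam => (hlaplace₁ lam hlam).2.trans (hlaplace₂ lam hlam).2.symm
  exact eq_of_ae_eq_of_continuousWithinAt_Iic (g₁ := fun t => w₁ t τ) ht hae
    (hcont₁ t ht) (hcont₂ t ht)

end IsPropagationFunction

/-! ### Distribution functions of laws on `[0, ∞]` -/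

/-- The distribution function `t ↦ P(-log x < t)` of the law on `[0, ∞]` that `μ` represents in
terms of `x = e^{-t}`. -/
noncomputable def logDistribution (μ : Measure I) (t : ℝ) : ℝ :=
  μ.real {x : I | Real.exp (-t) < x}

theorem measurableSet_exp_neg_lt (t : ℝ) : MeasurableSet {x : I | Real.exp (-t) < x} :=
  measurableSet_lt measurable_const measurable_subtype_coe

theorem logDistribution_nonneg (μ : Measure I) (t : ℝ) : 0 ≤ logDistribution μ t :=
  measureReal_nonneg

theorem logDistribution_le_one (μ : Measure I) [IsProbabilityMeasure μ] (t : ℝ) :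
    logDistribution μ t ≤ 1 :=
  measureReal_le_one

theorem logDistribution_zero (μ : Measure I) : logDistribution μ 0 = 0 := by
  have hempty : {x : I | Real.exp (-0) < x} = ∅ := by
    ext x
    simpa using x.2.2
  rw [logDistribution, hempty, measureReal_empty]

theorem monotone_logDistribution (μ : Measure I) [IsFiniteMeasure μ] :
    Monotone (logDistribution μ) := fun s t hst =>
  measureReal_mono fun x (hx : Real.exp (-s) < x) =>
    (Real.exp_le_exp.2 (neg_le_neg hst)).trans_lt hx

theorem continuousWithinAt_logDistribution (μ : Measure I) [IsFiniteMeasure μ] (t : ℝ) :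
    ContinuousWithinAt (logDistribution μ) (Iic t) t := by
  have hind (r : ℝ) : logDistribution μ r = ∫ x, {x : I | Real.exp (-r) < x}.indicator 1 x ∂μ :=
    (integral_indicator_one (measurableSet_exp_neg_lt r)).symm
  simp only [ContinuousWithinAt, funext hind]
  refine tendsto_integral_filter_of_dominated_convergence (fun _ => 1)
    (.of_forall fun r =>
      (measurable_one.indicator (measurableSet_exp_neg_lt r)).aestronglyMeasurable)
    (.of_forall fun r => .of_forall fun x =>
      (norm_indicator_le_norm_self _ _).trans (by simp)) (integrable_const _)
    (.of_forall fun x => tendsto_const_nhds.congr' ?_)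
  have hmem : ∀ᶠ r in 𝓝[≤] t, Real.exp (-t) < x ↔ Real.exp (-r) < x := by
    by_cases hx : Real.exp (-t) < x
    · have hcont : Continuous fun r : ℝ => Real.exp (-r) := by fun_prop
      filter_upwards [nhdsWithin_le_nhds (hcont.continuousAt.eventually_lt_const hx)] with r hr
      exact iff_of_true hx hr
    · filter_upwards [self_mem_nhdsWithin] with r hr
      exact iff_of_false hx fun h => hx ((Real.exp_le_exp.2 (neg_le_neg hr)).trans_lt h)
  filter_upwards [hmem] with r hr
  simp only [indicator_apply, mem_ofPred_eq, hr]

theorem logDistribution_mconv_le (μ ν : Measure I) [IsFiniteMeasure μ] [IsProbabilityMeasure ν]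
    (t : ℝ) : logDistribution (μ ∗ₘ ν) t ≤ logDistribution μ t := by
  rw [logDistribution, Measure.mconv,
    map_measureReal_apply measurable_mul (measurableSet_exp_neg_lt t)]
  calc (μ.prod ν).real ((fun x : I × I => x.1 * x.2) ⁻¹' {x : I | Real.exp (-t) < x})
      ≤ (μ.prod ν).real ({x : I | Real.exp (-t) < x} ×ˢ univ) :=
        measureReal_mono fun x (hx : Real.exp (-t) < (x.1 : ℝ) * x.2) =>
          ⟨hx.trans_le (mul_le_of_le_one_right x.1.2.1 x.2.2.2), mem_univ _⟩
    _ = logDistribution μ t := by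
        rw [measureReal_prod_prod, probReal_univ, mul_one, logDistribution]

theorem integral_exp_neg_mul_Ioi {lam : ℝ} (hlam : 0 < lam) (s : ℝ) :
    ∫ t in Ioi s, Real.exp (-(lam * t)) = Real.exp (-(lam * s)) / lam := by
  simpa only [neg_mul, neg_div_neg_eq] using integral_exp_mul_Ioi (neg_lt_zero.2 hlam) s

theorem laplace_indicator_exp_neg_lt {lam : ℝ} (hlam : 0 < lam) (x : I) :
    laplace (fun t => {x : I | Real.exp (-t) < x}.indicator 1 x) lam = (x : ℝ) ^ lam / lam := by
  rcases x.2.1.eq_or_lt with hx | hx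
  · have hzero (t : ℝ) : ¬Real.exp (-t) < 0 := (Real.exp_pos _).le.not_gt
    simp [laplace, ← hx, hzero, Real.zero_rpow hlam.ne']
  · have hind (t : ℝ) : Real.exp (-(lam * t)) * {x : I | Real.exp (-t) < x}.indicator 1 x
        = (Ioi (-Real.log x)).indicator (fun t => Real.exp (-(lam * t))) t := by
      simp [indicator_apply, ← Real.lt_log_iff_exp_lt hx, neg_lt]
    have hlog : 0 ≤ -Real.log x := neg_nonneg.2 (Real.log_nonpos x.2.1 x.2.2)
    simp only [laplace, hind]
    rw [setIntegral_indicator measurableSet_Ioi, Ioi_inter_Ioi, sup_eq_right.2 hlog,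
      integral_exp_neg_mul_Ioi hlam, Real.rpow_def_of_pos hx]
    ring_nf

theorem integrableOn_exp_mul_logDistribution (μ : Measure I) [IsProbabilityMeasure μ] {lam : ℝ}
    (hlam : 0 < lam) :
    IntegrableOn (fun t => Real.exp (-(lam * t)) * logDistribution μ t) (Ioi 0) := by
  refine (integrableOn_exp_neg_mul_Ioi hlam 0).mul_bdd (c := 1)
    (monotone_logDistribution μ).measurable.aestronglyMeasurable (.of_forall fun t => ?_)
  rw [Real.norm_of_nonneg (logDistribution_nonneg μ t)]
  exact logDistribution_le_one μ t

theorem laplace_logDistribution {μ : Measure I} [IsProbabilityMeasure μ] {F : ℝ → ℝ}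
    (h : HasPowerTransform μ F) {lam : ℝ} (hlam : 0 < lam) :
    laplace (logDistribution μ) lam = F lam / lam := by
  have hmeas : MeasurableSet {q : ℝ × I | Real.exp (-q.1) < q.2} :=
    measurableSet_lt (by fun_prop) (by fun_prop)
  have hint : Integrable (fun q : ℝ × I => Real.exp (-(lam * q.1))
      * {x : I | Real.exp (-q.1) < x}.indicator 1 q.2) ((volume.restrict (Ioi 0)).prod μ) :=
    ((integrableOn_exp_neg_mul_Ioi hlam 0).comp_fst μ).mul_bdd (c := 1)
      (measurable_one.indicator hmeas).aestronglyMeasurable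
      (.of_forall fun q => (norm_indicator_le_norm_self _ _).trans (by simp))
  calc laplace (logDistribution μ) lam
      = ∫ t in Ioi 0, ∫ x, Real.exp (-(lam * t))
          * {x : I | Real.exp (-t) < x}.indicator 1 x ∂μ := by
        simp only [laplace, integral_const_mul, logDistribution,
          integral_indicator_one (measurableSet_exp_neg_lt _)]
    _ = ∫ x, laplace (fun t => {x : I | Real.exp (-t) < x}.indicator 1 x) lam ∂μ :=
        integral_integral_swap hint
    _ = F lam / lam := by
        simp only [laplace_indicator_exp_neg_lt hlam]
        rw [integral_div, h lam hlam]

/-! ### The propagation function -/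

namespace IsLogConvexKernel

variable {m : ℝ → ℝ}

theorem exists_propagationLaw (hm : IsLogConvexKernel m) :
    ∃ μ : ℝ≥0 → ProbabilityMeasure I,
      (∀ τ : ℝ≥0, HasPowerTransform (μ τ : Measure I)
        fun lam => Real.exp (-(τ * laplaceExponent m lam))) ∧
      ∀ (t : ℝ) (τ : ℝ≥0), 0 ≤ t → propagation m t τ = logDistribution (μ τ) t := by
  choose μ hμ using fun τ : ℝ≥0 => hm.isPowerTransform_exp_laplaceExponent τ.2
  have hw : IsPropagationFunction m fun t τ => logDistribution (μ τ.toNNReal) t := by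
    intro τ hτ
    have hF := hμ τ.toNNReal
    rw [NNReal.val_eq_coe, Real.coe_toNNReal τ hτ] at hF
    exact ⟨(monotone_logDistribution _).monotoneOn _, logDistribution_zero _,
      fun t _ => continuousWithinAt_logDistribution _ t, fun lam hlam =>
        ⟨integrableOn_exp_mul_logDistribution _ hlam, laplace_logDistribution hF hlam⟩⟩
  have hex : ∃ w, IsPropagationFunction m w := ⟨_, hw⟩
  refine ⟨μ, hμ, fun t τ ht => ?_⟩
  rw [propagation, dif_pos hex, hex.choose_spec.unique hw ht τ.coe_nonneg, Real.toNNReal_coe]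

theorem propagation_mem_Icc (hm : IsLogConvexKernel m) {t τ : ℝ} (ht : 0 ≤ t) (hτ : 0 ≤ τ) :
    propagation m t τ ∈ Icc 0 1 := by
  obtain ⟨μ, -, hμ⟩ := hm.exists_propagationLaw
  lift τ to ℝ≥0 using hτ
  rw [hμ t τ ht]
  exact ⟨logDistribution_nonneg _ t, logDistribution_le_one _ t⟩

theorem propagation_mono_time (hm : IsLogConvexKernel m) {s t τ : ℝ} (hs : 0 ≤ s) (hst : s ≤ t)
    (hτ : 0 ≤ τ) : propagation m s τ ≤ propagation m t τ := by
  obtain ⟨μ, -, hμ⟩ := hm.exists_propagationLaw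
  lift τ to ℝ≥0 using hτ
  rw [hμ s τ hs, hμ t τ (hs.trans hst)]
  exact monotone_logDistribution _ hst

/-- The laws form a convolution semigroup in `τ`, so that increasing `τ` means adding an independent
nonnegative variable. -/
theorem propagation_anti (hm : IsLogConvexKernel m) {t s τ : ℝ} (ht : 0 ≤ t) (hs : 0 ≤ s)
    (hsτ : s ≤ τ) : propagation m t τ ≤ propagation m t s := by
  obtain ⟨μ, htransform, hμ⟩ := hm.exists_propagationLaw
  obtain ⟨r, hr, rfl⟩ : ∃ r, 0 ≤ r ∧ τ = s + r := ⟨τ - s, sub_nonneg.2 hsτ, by ring⟩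
  lift s to ℝ≥0 using hs
  lift r to ℝ≥0 using hr
  have hconv : HasPowerTransform (μ s ∗ₘ μ r : Measure I)
      fun lam => Real.exp (-((s + r : ℝ≥0) * laplaceExponent m lam)) := by
    convert (htransform s).mconv (htransform r) using 2 with lam
    rw [← Real.exp_add, NNReal.coe_add]
    ring_nf
  rw [← NNReal.coe_add, hμ t s ht, hμ t (s + r) ht, (htransform (s + r)).unique hconv]
  exact logDistribution_mconv_le _ _ t

end IsLogConvexKernel

/-! ### The heat semigroup -/

theorem heatKernel_nonneg (d : ℕ) {τ : ℝ} (hτ : 0 ≤ τ) (y : EuclideanSpace ℝ (Fin d)) :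
    0 ≤ heatKernel d τ y := by
  unfold heatKernel
  positivity

theorem integral_heatKernel (d : ℕ) {τ : ℝ} (hτ : 0 < τ) :
    ∫ y : EuclideanSpace ℝ (Fin d), heatKernel d τ y = 1 := by
  have gaussian := GaussianFourier.integral_rexp_neg_mul_sq_norm (V := EuclideanSpace ℝ (Fin d))
    (show 0 < 1 / (4 * τ) by positivity)
  have exponent_eq (y : EuclideanSpace ℝ (Fin d)) :
      -‖y‖ ^ 2 / (4 * τ) = -(1 / (4 * τ)) * ‖y‖ ^ 2 := by ring
  have constant_eq : Real.pi / (1 / (4 * τ)) = 4 * Real.pi * τ := by field_simp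
  simp only [heatKernel, exponent_eq]
  rw [integral_const_mul, gaussian, finrank_euclideanSpace_fin, constant_eq,
    ← Real.rpow_add (by positivity), neg_div, neg_add_cancel, Real.rpow_zero]

theorem integrable_heatKernel (d : ℕ) {τ : ℝ} (hτ : 0 < τ) : Integrable (heatKernel d τ) :=
  not_imp_comm.1 integral_undef (by rw [integral_heatKernel d hτ]; exact one_ne_zero)

theorem measurable_heatKernel (d : ℕ) :
    Measurable fun q : ℝ × EuclideanSpace ℝ (Fin d) => heatKernel d q.1 q.2 := by
  unfold heatKernel
  fun_prop

section HeatSemigroup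

variable {𝕜 : Type} [RCLike 𝕜] {d : ℕ} {p : ℝ≥0∞}

theorem translate_sub (y : EuclideanSpace ℝ (Fin d)) (u v : LpSpace 𝕜 d p) :
    translate y (u - v) = translate y u - translate y v :=
  map_sub (Lp.compMeasurePreserving _ _) u v

theorem norm_translate (y : EuclideanSpace ℝ (Fin d)) (v : LpSpace 𝕜 d p) :
    ‖translate y v‖ = ‖v‖ :=
  Lp.norm_compMeasurePreserving v _

variable [Fact (1 ≤ p)]

theorem continuous_translate (hp : p ≠ ∞) (v : LpSpace 𝕜 d p) :
    Continuous fun y : EuclideanSpace ℝ (Fin d) => translate y v := by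
  have continuous_sub_swap :
      Continuous fun q : EuclideanSpace ℝ (Fin d) × EuclideanSpace ℝ (Fin d) => q.2 - q.1 := by
    fun_prop
  exact Continuous.compMeasurePreservingLp
    (g := fun y => (⟨fun x => x - y, by fun_prop⟩ : C(EuclideanSpace ℝ (Fin d), _)))
    continuous_const (ContinuousMap.continuous_of_continuous_uncurry _ continuous_sub_swap) _ hp

theorem integrable_heatKernel_smul_translate (hp : p ≠ ∞) {τ : ℝ} (hτ : 0 < τ)
    (v : LpSpace 𝕜 d p) :
    Integrable fun y : EuclideanSpace ℝ (Fin d) => heatKernel d τ y • translate y v := by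
  refine ((integrable_heatKernel d hτ).mul_const ‖v‖).mono
    ((integrable_heatKernel d hτ).1.smul (continuous_translate hp v).aestronglyMeasurable)
    (Eventually.of_forall fun y => ?_)
  rw [norm_smul, norm_translate, norm_mul, norm_norm]

theorem heatSemigroup_sub (hp : p ≠ ∞) (τ : ℝ) (u v : LpSpace 𝕜 d p) :
    heatSemigroup τ (u - v) = heatSemigroup τ u - heatSemigroup τ v := by
  unfold heatSemigroup
  split_ifs with hτ
  · rfl
  · rw [← integral_sub (integrable_heatKernel_smul_translate hp (not_le.1 hτ) u)
      (integrable_heatKernel_smul_translate hp (not_le.1 hτ) v)]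
    simp only [translate_sub, smul_sub]

theorem norm_heatSemigroup_le (τ : ℝ) (v : LpSpace 𝕜 d p) : ‖heatSemigroup τ v‖ ≤ ‖v‖ := by
  unfold heatSemigroup
  split_ifs with hτ
  · rfl
  · rw [not_le] at hτ
    calc ‖∫ y, heatKernel d τ y • translate y v‖
        ≤ ∫ y, ‖heatKernel d τ y • translate y v‖ := norm_integral_le_integral_norm _
      _ = ∫ y, heatKernel d τ y * ‖v‖ := by
        simp only [norm_smul, norm_translate, Real.norm_of_nonneg (heatKernel_nonneg d hτ.le _)]
      _ = ‖v‖ := by rw [integral_mul_const, integral_heatKernel d hτ, one_mul]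

theorem stronglyMeasurable_heatSemigroup (hp : p ≠ ∞) (v : LpSpace 𝕜 d p) :
    StronglyMeasurable fun τ : ℝ => heatSemigroup τ v := by
  refine StronglyMeasurable.ite measurableSet_Iic stronglyMeasurable_const ?_
  refine StronglyMeasurable.integral_prod_right
    (f := fun (τ : ℝ) (y : EuclideanSpace ℝ (Fin d)) => heatKernel d τ y • translate y v) ?_
  exact (measurable_heatKernel d).stronglyMeasurable.smul
    ((continuous_translate hp v).stronglyMeasurable.comp_measurable measurable_snd)

theorem integrable_heatSemigroup (hp : p ≠ ∞) (μ : Measure ℝ) [IsFiniteMeasure μ]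
    (v : LpSpace 𝕜 d p) : Integrable (fun τ => heatSemigroup τ v) μ :=
  Integrable.of_bound (stronglyMeasurable_heatSemigroup hp v).aestronglyMeasurable ‖v‖
    (Eventually.of_forall fun τ => norm_heatSemigroup_le τ v)

end HeatSemigroup

/-! ### The subordinating measures and the solution operators -/

namespace IsLogConvexKernel

variable {m : ℝ → ℝ} {s t : ℝ}

theorem negPropagation_mem_Icc (hm : IsLogConvexKernel m) (ht : 0 ≤ t) (τ : ℝ) :
    negPropagation m t τ ∈ Icc (-1 : ℝ) 0 := by
  unfold negPropagation
  split_ifs with hτ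
  · norm_num
  · obtain ⟨nonneg, le_one⟩ := hm.propagation_mem_Icc ht (not_lt.1 hτ)
    exact ⟨neg_le_neg le_one, neg_nonpos.2 nonneg⟩

theorem monotone_negPropagation (hm : IsLogConvexKernel m) (ht : 0 ≤ t) :
    Monotone (negPropagation m t) := by
  intro r τ hr
  by_cases hr_neg : r < 0
  · rw [negPropagation, if_pos hr_neg]
    exact (hm.negPropagation_mem_Icc ht τ).1
  · have hτ : ¬ τ < 0 := fun hτ => hr_neg (hr.trans_lt hτ)
    rw [negPropagation, negPropagation, if_neg hr_neg, if_neg hτ]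
    exact neg_le_neg (hm.propagation_anti ht (not_lt.1 hr_neg) hr)

theorem negPropagation_anti_time (hm : IsLogConvexKernel m) (hs : 0 ≤ s) (hst : s ≤ t) (τ : ℝ) :
    negPropagation m t τ ≤ negPropagation m s τ := by
  unfold negPropagation
  split_ifs with hτ
  · rfl
  · exact neg_le_neg (hm.propagation_mono_time hs hst (not_lt.1 hτ))

theorem tendsto_rightLim_negPropagation_atBot (hm : IsLogConvexKernel m) (ht : 0 ≤ t) :
    Tendsto (Function.rightLim (negPropagation m t)) atBot (𝓝 (-1)) := by
  have hmono := hm.monotone_negPropagation ht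
  refine tendsto_const_nhds.congr' ?_
  filter_upwards [eventually_lt_atBot (-1 : ℝ)] with τ hτ
  refine le_antisymm ((hm.negPropagation_mem_Icc ht τ).1.trans (hmono.le_rightLim le_rfl)) ?_
  refine (hmono.rightLim_le (show τ < -1 from hτ)).trans_eq ?_
  rw [negPropagation, if_pos (by norm_num)]

theorem propagationMeasure_Iic (hm : IsLogConvexKernel m) (ht : 0 ≤ t) (τ : ℝ) :
    propagationMeasure m t (Iic τ) =
      ENNReal.ofReal (Function.rightLim (negPropagation m t) τ - -1) := by
  rw [propagationMeasure, dif_pos (hm.monotone_negPropagation ht)]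
  exact StieltjesFunction.measure_Iic _ (hm.tendsto_rightLim_negPropagation_atBot ht) τ

theorem propagationMeasure_univ_le_one (hm : IsLogConvexKernel m) (ht : 0 ≤ t) :
    propagationMeasure m t univ ≤ 1 := by
  refine le_of_tendsto' (tendsto_measure_Iic_atTop _) fun τ => ?_
  rw [hm.propagationMeasure_Iic ht, ENNReal.ofReal_le_one]
  linarith [(hm.monotone_negPropagation ht).rightLim_le (lt_add_one τ),
    (hm.negPropagation_mem_Icc ht (τ + 1)).2]

theorem isFiniteMeasure_propagationMeasure (hm : IsLogConvexKernel m) (ht : 0 ≤ t) :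
    IsFiniteMeasure (propagationMeasure m t) :=
  ⟨(hm.propagationMeasure_univ_le_one ht).trans_lt ENNReal.one_lt_top⟩

theorem propagationMeasure_Iic_anti (hm : IsLogConvexKernel m) (hs : 0 ≤ s) (hst : s ≤ t)
    (τ : ℝ) : propagationMeasure m t (Iic τ) ≤ propagationMeasure m s (Iic τ) := by
  have ht := hs.trans hst
  rw [hm.propagationMeasure_Iic hs, hm.propagationMeasure_Iic ht]
  refine ENNReal.ofReal_le_ofReal (sub_le_sub_right ?_ _)
  exact le_of_tendsto_of_tendsto' ((hm.monotone_negPropagation ht).tendsto_rightLim τ)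
    ((hm.monotone_negPropagation hs).tendsto_rightLim τ) (hm.negPropagation_anti_time hs hst)

theorem measurable_propagationMeasure (hm : IsLogConvexKernel m) :
    Measurable fun t : ℝ≥0 => propagationMeasure m t := by
  have hfinite (t : ℝ≥0) : IsFiniteMeasure (propagationMeasure m t) :=
    hm.isFiniteMeasure_propagationMeasure t.coe_nonneg
  have measurable_Iic (τ : ℝ) : Measurable fun t : ℝ≥0 => propagationMeasure m t (Iic τ) :=
    Antitone.measurable fun s t hst =>
      hm.propagationMeasure_Iic_anti s.coe_nonneg (NNReal.coe_le_coe.2 hst) τ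
  refine Measurable.measure_of_isPiSystem (borel_eq_generateFrom_Iic ℝ ▸ BorelSpace.measurable_eq)
    isPiSystem_Iic ?_ ?_
  · rintro _ ⟨τ, rfl⟩
    exact measurable_Iic τ
  · refine measurable_of_tendsto_metrizable (fun n : ℕ => measurable_Iic n) ?_
    exact tendsto_pi_nhds.2 fun t =>
      (tendsto_measure_Iic_atTop _).comp tendsto_natCast_atTop_atTop

variable {k : ℝ → ℝ} {𝕜 : Type} [RCLike 𝕜] {d : ℕ} {p : ℝ≥0∞} [Fact (1 ≤ p)]

theorem solutionOperator_sub (hm : IsLogConvexKernel fun r => 1 + k r) (hp : p ≠ ∞)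
    (ht : 0 ≤ t) (u v : LpSpace 𝕜 d p) :
    solutionOperator k t (u - v) = solutionOperator k t u - solutionOperator k t v := by
  have := hm.isFiniteMeasure_propagationMeasure ht
  simp only [solutionOperator, heatSemigroup_sub hp]
  exact integral_sub (integrable_heatSemigroup hp _ u) (integrable_heatSemigroup hp _ v)

theorem norm_solutionOperator_le (hm : IsLogConvexKernel fun r => 1 + k r) (ht : 0 ≤ t)
    (v : LpSpace 𝕜 d p) : ‖solutionOperator k t v‖ ≤ ‖v‖ := by
  have := hm.isFiniteMeasure_propagationMeasure ht
  refine (norm_integral_le_of_norm_le_const (Eventually.of_forall fun τ =>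
    norm_heatSemigroup_le τ v)).trans (mul_le_of_le_one_right (norm_nonneg _) ?_)
  exact ENNReal.toReal_le_of_le_ofReal zero_le_one
    (by simpa only [ENNReal.ofReal_one] using hm.propagationMeasure_univ_le_one ht)

theorem stronglyMeasurable_solutionOperator (hm : IsLogConvexKernel fun r => 1 + k r)
    (hp : p ≠ ∞) (v : LpSpace 𝕜 d p) :
    StronglyMeasurable fun t : ℝ≥0 => solutionOperator k t v := by
  let κ : ProbabilityTheory.Kernel ℝ≥0 ℝ := ⟨fun t => propagationMeasure (fun r => 1 + k r) t,
    hm.measurable_propagationMeasure⟩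
  exact (stronglyMeasurable_heatSemigroup hp v).integral_kernel (κ := κ)

end IsLogConvexKernel

/-! ### Volterra equations with a family of Lipschitz maps as kernel -/

section Volterra

variable {X : Type*} [NormedAddCommGroup X]

/-- The kernels `A` of the nonlinear convolution equations `u(t) = φ(t) + ∫₀ᵗ A(t - τ)(u(τ)) dτ`
considered here: a strongly measurable family of `L`-Lipschitz maps, bounded at the origin. -/
structure IsLipschitzFamily (A : ℝ≥0 → X → X) (L : ℝ≥0) : Prop where
  lipschitz : ∀ t, LipschitzWith L (A t)
  stronglyMeasurable : ∀ x, StronglyMeasurable fun t => A t x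
  bounded_zero : ∃ M, ∀ t, ‖A t 0‖ ≤ M

/-- The translated path `r ↦ u(s + r)`. -/
def shiftPath (s : ℝ≥0) (u : C(ℝ≥0, X)) : C(ℝ≥0, X) := ⟨fun r => u (s + r), by fun_prop⟩

theorem shiftPath_apply (s : ℝ≥0) (u : C(ℝ≥0, X)) (r : ℝ≥0) : shiftPath s u r = u (s + r) := rfl

variable {A : ℝ≥0 → X → X} {L : ℝ≥0}

theorem continuous_path_toNNReal (u : C(ℝ≥0, X)) : Continuous fun τ : ℝ => u τ.toNNReal :=
  u.continuous.comp continuous_real_toNNReal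

namespace IsLipschitzFamily

theorem exists_norm_le (hA : IsLipschitzFamily A L) :
    ∃ M, ∀ t x, ‖A t x‖ ≤ M + L * ‖x‖ := by
  obtain ⟨M, hM⟩ := hA.bounded_zero
  refine ⟨M, fun t x => (norm_le_norm_add_norm_sub' (A t x) (A t 0)).trans ?_⟩
  exact add_le_add (hM t) (by simpa only [sub_zero] using (hA.lipschitz t).norm_sub_le x 0)

theorem stronglyMeasurable_comp (hA : IsLipschitzFamily A L) (u : C(ℝ≥0, X)) {a b : ℝ → ℝ}
    (ha : Measurable a) (hb : Measurable b) :
    StronglyMeasurable fun τ => A (a τ).toNNReal (u (b τ).toNNReal) := by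
  have joint : StronglyMeasurable (Function.uncurry fun r t : ℝ≥0 => A t (u r)) :=
    stronglyMeasurable_uncurry_of_continuous_of_stronglyMeasurable
      (fun t => (hA.lipschitz t).continuous.comp u.continuous)
      fun r => hA.stronglyMeasurable (u r)
  exact joint.comp_measurable (hb.real_toNNReal.prodMk ha.real_toNNReal)

theorem intervalIntegrable (hA : IsLipschitzFamily A L) (u : C(ℝ≥0, X)) (r a b : ℝ) :
    IntervalIntegrable (fun τ => A (r - τ).toNNReal (u τ.toNNReal)) volume a b := by
  obtain ⟨M, hM⟩ := hA.exists_norm_le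
  refine IntervalIntegrable.mono_fun' (g := fun τ => M + L * ‖u τ.toNNReal‖) ?_
    (hA.stronglyMeasurable_comp u (by fun_prop) measurable_id).aestronglyMeasurable
    (Eventually.of_forall fun τ => hM _ _)
  exact (continuous_const.add (continuous_const.mul
    (continuous_path_toNNReal u).norm)).intervalIntegrable a b

end IsLipschitzFamily

variable [NormedSpace ℝ X]

/-- The Duhamel term `∫₀ᵗ A(t + θ - τ)(u(τ)) dτ`: the influence at time `t + θ` of the path `u`
up to time `t`. -/
noncomputable def duhamel (A : ℝ≥0 → X → X) (u : C(ℝ≥0, X)) (t θ : ℝ≥0) : X :=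
  ∫ τ in (0 : ℝ)..t, A (t + θ - τ : ℝ).toNNReal (u τ.toNNReal)

/-- `u` solves the Volterra equation `u(t) = φ(t) + ∫₀ᵗ A(t - τ)(u(τ)) dτ`. -/
def IsVolterraSolution (A : ℝ≥0 → X → X) (φ u : C(ℝ≥0, X)) : Prop :=
  ∀ t : ℝ≥0, u t = φ t + duhamel A u t 0

theorem duhamel_zero_left (A : ℝ≥0 → X → X) (u : C(ℝ≥0, X)) (θ : ℝ≥0) : duhamel A u 0 θ = 0 := by
  rw [duhamel, NNReal.coe_zero, intervalIntegral.integral_same]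

/-- After this substitution `t` and `θ` enter through the path and the endpoints only, and not
through `A`, which is merely measurable in time. -/
theorem duhamel_eq_integral_comp_sub (A : ℝ≥0 → X → X) (u : C(ℝ≥0, X)) (t θ : ℝ≥0) :
    duhamel A u t θ = ∫ s in (θ : ℝ)..t + θ, A s.toNNReal (u (t + θ - s).toNNReal) := by
  have substitution := intervalIntegral.integral_comp_sub_left (a := 0) (b := t)
    (fun s => A s.toNNReal (u (t + θ - s).toNNReal)) (t + θ : ℝ)
  simpa only [duhamel, sub_sub_cancel, sub_zero, add_sub_cancel_left] using substitution

namespace IsLipschitzFamily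

theorem continuous_primitive (hA : IsLipschitzFamily A L) (u : C(ℝ≥0, X)) :
    Continuous fun q : ℝ × ℝ => ∫ s in (0 : ℝ)..q.2, A s.toNNReal (u (q.1 - s).toNNReal) := by
  obtain ⟨M, hM⟩ := hA.exists_norm_le
  refine continuous_iff_continuousAt.2 fun ⟨r₀, b₀⟩ => ?_
  set a := min 0 b₀ - 1
  set b := max 0 b₀ + 1
  have zero_mem : (0 : ℝ) ∈ Ioo a b := by grind
  have b₀_mem : b₀ ∈ Ioo a b := by grind
  obtain ⟨B, hB⟩ := isCompact_Icc (a := r₀ - 1 - b) (b := r₀ + 1 - a)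
    |>.exists_bound_of_continuousOn (continuous_path_toNNReal u).continuousOn
  refine intervalIntegral.continuousAt_parametric_primitive_of_dominated
    (F := fun r s => A s.toNNReal (u (r - s).toNNReal)) (fun _ => M + L * B) a b
    (fun r => (hA.stronglyMeasurable_comp u measurable_id (by fun_prop)).aestronglyMeasurable)
    ?_ intervalIntegrable_const (ae_of_all _ fun s => ?_) zero_mem b₀_mem
    (measure_singleton b₀)
  · filter_upwards [Icc_mem_nhds (sub_one_lt r₀) (lt_add_one r₀)] with r hr
    filter_upwards [ae_restrict_mem measurableSet_uIoc] with s hs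
    rw [uIoc_of_le (by grind)] at hs
    exact (hM _ _).trans (add_le_add_right (mul_le_mul_of_nonneg_left
      (hB _ ⟨sub_le_sub hr.1 hs.2, sub_le_sub hr.2 hs.1.le⟩) L.coe_nonneg) M)
  · exact ((hA.lipschitz _).continuous.comp ((continuous_path_toNNReal u).comp
      (continuous_id.sub continuous_const))).continuousAt

theorem continuous_duhamel (hA : IsLipschitzFamily A L) (u : C(ℝ≥0, X)) :
    Continuous fun q : ℝ≥0 × ℝ≥0 => duhamel A u q.1 q.2 := by
  let primitive (q : ℝ × ℝ) : X := ∫ s in (0 : ℝ)..q.2, A s.toNNReal (u (q.1 - s).toNNReal)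
  have continuous_comp {g : ℝ≥0 × ℝ≥0 → ℝ × ℝ} (hg : Continuous g) :
      Continuous fun q => primitive (g q) := (hA.continuous_primitive u).comp hg
  have duhamel_eq (q : ℝ≥0 × ℝ≥0) : duhamel A u q.1 q.2 =
      primitive (q.1 + q.2, q.1 + q.2) - primitive (q.1 + q.2, q.2) := by
    have integrable (c : ℝ) : IntervalIntegrable
        (fun s => A s.toNNReal (u (q.1 + q.2 - s : ℝ).toNNReal)) volume 0 c := by
      simpa only [sub_sub_cancel, sub_self] using
        (hA.intervalIntegrable u (q.1 + q.2) (q.1 + q.2) (q.1 + q.2 - c)).comp_sub_left (q.1 + q.2)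
    rw [duhamel_eq_integral_comp_sub]
    exact (intervalIntegral.integral_interval_sub_left (integrable _) (integrable _)).symm
  simp only [duhamel_eq]
  exact (continuous_comp (by fun_prop)).sub (continuous_comp (by fun_prop))

/-- In the weighted norm `sup_{τ ≤ t} e^{-2Lτ}‖u(τ)‖` the Duhamel term contracts by `1/2`. -/
theorem norm_duhamel_sub_le (hA : IsLipschitzFamily A L) {u v : C(ℝ≥0, X)} {C : ℝ} {t : ℝ≥0}
    (h : ∀ τ ≤ t, ‖u τ - v τ‖ ≤ C * Real.exp (2 * L * τ)) (θ : ℝ≥0) :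
    ‖duhamel A u t θ - duhamel A v t θ‖ ≤ C / 2 * Real.exp (2 * L * t) := by
  have hC : 0 ≤ C := by simpa using (norm_nonneg _).trans (h 0 zero_le)
  have pointwise (τ : ℝ) (hτ : τ ∈ Ioc (0 : ℝ) t) :
      ‖A (t + θ - τ : ℝ).toNNReal (u τ.toNNReal) - A (t + θ - τ : ℝ).toNNReal (v τ.toNNReal)‖
        ≤ L * (C * Real.exp (2 * L * τ)) := by
    refine ((hA.lipschitz _).norm_sub_le _ _).trans
      (mul_le_mul_of_nonneg_left ?_ L.coe_nonneg)
    simpa only [Real.coe_toNNReal τ hτ.1.le] using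
      h τ.toNNReal (Real.toNNReal_le_iff_le_coe.2 hτ.2)
  have integral_bound : ∫ τ in (0 : ℝ)..t, L * (C * Real.exp (2 * L * τ)) =
      C / 2 * Real.exp (2 * L * t) - C / 2 := by
    have hderiv (τ : ℝ) : HasDerivAt (fun τ : ℝ => C / 2 * Real.exp (2 * L * τ))
        (L * (C * Real.exp (2 * L * τ))) τ :=
      (((hasDerivAt_id τ).const_mul (2 * L : ℝ)).exp.const_mul (C / 2)).congr_deriv
        (by rw [id_eq]; ring)
    rw [intervalIntegral.integral_eq_sub_of_hasDerivAt (fun τ _ => hderiv τ)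
      ((by fun_prop : Continuous _).intervalIntegrable _ _), mul_zero, Real.exp_zero, mul_one]
  rw [duhamel, duhamel, ← intervalIntegral.integral_sub (hA.intervalIntegrable u _ 0 t)
    (hA.intervalIntegrable v _ 0 t)]
  refine (intervalIntegral.norm_integral_le_of_norm_le t.coe_nonneg (ae_of_all _ pointwise)
    ((by fun_prop : Continuous _).intervalIntegrable _ _)).trans ?_
  linarith

theorem norm_sub_le_of_isVolterraSolution (hA : IsLipschitzFamily A L) {φ ψ u v : C(ℝ≥0, X)}
    (hu : IsVolterraSolution A φ u) (hv : IsVolterraSolution A ψ v) {C : ℝ} {T : ℝ≥0}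
    (h : ∀ t ≤ T, ‖φ t - ψ t‖ ≤ C) {t : ℝ≥0} (ht : t ≤ T) :
    ‖u t - v t‖ ≤ 2 * C * Real.exp (2 * L * t) := by
  have hweighted : Continuous fun t : ℝ≥0 => ‖u t - v t‖ / Real.exp (2 * L * t) :=
    Continuous.div (by fun_prop) (by fun_prop) fun t => (Real.exp_pos _).ne'
  obtain ⟨t₀, ht₀, isMax⟩ := isCompact_Icc.exists_isMaxOn (nonempty_Icc.2 (zero_le (a := T)))
    hweighted.continuousOn
  set D := ‖u t₀ - v t₀‖ / Real.exp (2 * L * t₀)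
  have le_weighted (τ : ℝ≥0) (hτ : τ ≤ T) : ‖u τ - v τ‖ ≤ D * Real.exp (2 * L * τ) :=
    (div_le_iff₀ (Real.exp_pos _)).1 (isMax ⟨zero_le, hτ⟩)
  have D_le : D ≤ C + D / 2 := by
    rw [div_le_iff₀ (Real.exp_pos _), add_mul]
    calc ‖u t₀ - v t₀‖ = ‖φ t₀ - ψ t₀ + (duhamel A u t₀ 0 - duhamel A v t₀ 0)‖ := by
          rw [hu t₀, hv t₀, add_sub_add_comm]
      _ ≤ C + D / 2 * Real.exp (2 * L * t₀) := norm_add_le_of_le (h t₀ ht₀.2)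
          (hA.norm_duhamel_sub_le (fun τ hτ => le_weighted τ (hτ.trans ht₀.2)) 0)
      _ ≤ C * Real.exp (2 * L * t₀) + D / 2 * Real.exp (2 * L * t₀) :=
          add_le_add_left (le_mul_of_one_le_right ((norm_nonneg _).trans (h t₀ ht₀.2))
            (Real.one_le_exp (by positivity))) _
  exact (le_weighted t ht).trans (by gcongr; linarith)

theorem eq_of_isVolterraSolution (hA : IsLipschitzFamily A L) {φ u v : C(ℝ≥0, X)}
    (hu : IsVolterraSolution A φ u) (hv : IsVolterraSolution A φ v) : u = v := by
  ext t
  have norm_le := hA.norm_sub_le_of_isVolterraSolution hu hv (C := 0) (T := t) (by simp) le_rfl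
  exact sub_eq_zero.1 (norm_le_zero_iff.1 (by simpa only [mul_zero, zero_mul] using norm_le))

/-- The map `u ↦ φ + ∫₀ᵗ A(t - τ)(u(τ)) dτ`, whose fixed points are the solutions of the Volterra
equation. -/
noncomputable def picardMap (hA : IsLipschitzFamily A L) (φ u : C(ℝ≥0, X)) : C(ℝ≥0, X) where
  toFun t := φ t + duhamel A u t 0
  continuous_toFun := φ.continuous.add ((hA.continuous_duhamel u).comp (Continuous.prodMk_left 0))

theorem picardMap_sub_picardMap_apply (hA : IsLipschitzFamily A L) (φ u v : C(ℝ≥0, X)) (t : ℝ≥0) :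
    (hA.picardMap φ u - hA.picardMap φ v) t = duhamel A u t 0 - duhamel A v t 0 :=
  add_sub_add_left_eq_sub (duhamel A u t 0) (duhamel A v t 0) (φ t)

theorem norm_picard_iterate_succ_sub_le (hA : IsLipschitzFamily A L) (φ : C(ℝ≥0, X)) {T : ℝ≥0}
    {M : ℝ} (hM : ∀ t ≤ T, ‖hA.picardMap φ φ t - φ t‖ ≤ M) (n : ℕ) {t : ℝ≥0} (ht : t ≤ T) :
    ‖(hA.picardMap φ)^[n + 1] φ t - (hA.picardMap φ)^[n] φ t‖
      ≤ M / 2 ^ n * Real.exp (2 * L * t) := by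
  induction n generalizing t with
  | zero =>
    rw [pow_zero, div_one]
    exact (hM t ht).trans (le_mul_of_one_le_right ((norm_nonneg _).trans (hM t ht))
      (Real.one_le_exp (by positivity)))
  | succ n ih =>
    rw [pow_succ, ← div_div, Function.iterate_succ_apply' (hA.picardMap φ) (n + 1)]
    nth_rw 2 [Function.iterate_succ_apply' (hA.picardMap φ) n]
    rw [← ContinuousMap.sub_apply, picardMap_sub_picardMap_apply]
    exact hA.norm_duhamel_sub_le (fun τ hτ => ih (hτ.trans ht)) 0

theorem continuous_duhamel_path (hA : IsLipschitzFamily A L) (t θ : ℝ≥0) :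
    Continuous fun u => duhamel A u t θ := by
  refine continuous_iff_continuousAt.2 fun v => Metric.tendsto_nhds.2 fun ε hε => ?_
  have uniform_on_Icc := ContinuousMap.tendsto_iff_forall_isCompact_tendstoUniformlyOn.1
    (tendsto_id (x := 𝓝 v)) (Icc 0 t) isCompact_Icc
  filter_upwards [Metric.tendstoUniformlyOn_iff.1 uniform_on_Icc (ε / Real.exp (2 * L * t))
    (by positivity)] with u hu
  have sub_le (τ : ℝ≥0) (hτ : τ ≤ t) :
      ‖u τ - v τ‖ ≤ ε / Real.exp (2 * L * t) * Real.exp (2 * L * τ) :=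
    ((dist_eq_norm' (v τ) (u τ)).symm.trans_le (hu τ ⟨zero_le, hτ⟩).le).trans
      (le_mul_of_one_le_right (by positivity) (Real.one_le_exp (by positivity)))
  calc dist (duhamel A u t θ) (duhamel A v t θ)
      ≤ ε / Real.exp (2 * L * t) / 2 * Real.exp (2 * L * t) :=
        (dist_eq_norm _ _).trans_le (hA.norm_duhamel_sub_le sub_le θ)
    _ = ε / 2 := by field_simp
    _ < ε := half_lt_self hε

theorem summable_picard_iterate_succ_sub [CompleteSpace X] (hA : IsLipschitzFamily A L)
    (φ : C(ℝ≥0, X)) :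
    Summable fun n => (hA.picardMap φ)^[n + 1] φ - (hA.picardMap φ)^[n] φ := by
  refine ContinuousMap.summable_of_locally_summable_norm fun K => ?_
  obtain ⟨T, hT⟩ := K.isCompact.bddAbove
  obtain ⟨M, hM⟩ := (isCompact_Icc (a := 0) (b := T)).exists_bound_of_continuousOn
    (hA.picardMap φ φ - φ).continuous.continuousOn
  have hM₀ : 0 ≤ M := (norm_nonneg _).trans (hM 0 ⟨le_rfl, zero_le⟩)
  refine Summable.of_nonneg_of_le (fun n => norm_nonneg _) (fun n => ?_)
    (summable_geometric_two.mul_left (M * Real.exp (2 * L * T)))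
  refine (ContinuousMap.norm_le _ (by positivity)).2 fun ⟨t, ht⟩ => ?_
  have htT : (t : ℝ) ≤ T := NNReal.coe_le_coe.2 (hT ht)
  calc ‖(hA.picardMap φ)^[n + 1] φ t - (hA.picardMap φ)^[n] φ t‖
      ≤ M / 2 ^ n * Real.exp (2 * L * t) :=
        hA.norm_picard_iterate_succ_sub_le φ (fun τ hτ => hM τ ⟨zero_le, hτ⟩) n (hT ht)
    _ ≤ M / 2 ^ n * Real.exp (2 * L * T) := by gcongr
    _ = M * Real.exp (2 * L * T) * (1 / 2) ^ n := by rw [one_div_pow]; ring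

theorem exists_isVolterraSolution [CompleteSpace X] (hA : IsLipschitzFamily A L)
    (φ : C(ℝ≥0, X)) : ∃ u, IsVolterraSolution A φ u := by
  obtain ⟨w, hw⟩ := hA.summable_picard_iterate_succ_sub φ
  have tendsto_iterate : Tendsto (fun n => (hA.picardMap φ)^[n] φ) atTop (𝓝 (φ + w)) := by
    refine (hw.tendsto_sum_nat.const_add φ).congr fun n => ?_
    rw [Finset.sum_range_sub fun n => (hA.picardMap φ)^[n] φ, Function.iterate_zero_apply,
      add_sub_cancel]
  refine ⟨φ + w, fun t => tendsto_nhds_unique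
    ((tendsto_iterate.eval_const t).comp (tendsto_add_atTop_nat 1)) ?_⟩
  refine ((((hA.continuous_duhamel_path t 0).tendsto (φ + w)).comp
    tendsto_iterate).const_add (φ t)).congr fun n => ?_
  rw [Function.comp_apply, Function.comp_apply, Function.iterate_succ_apply']
  rfl

/-- The unique solution of the Volterra equation with forcing term `φ`. -/
noncomputable def solution [CompleteSpace X] (hA : IsLipschitzFamily A L) (φ : C(ℝ≥0, X)) :
    C(ℝ≥0, X) :=
  (hA.exists_isVolterraSolution φ).choose

theorem isVolterraSolution_solution [CompleteSpace X] (hA : IsLipschitzFamily A L)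
    (φ : C(ℝ≥0, X)) : IsVolterraSolution A φ (hA.solution φ) :=
  (hA.exists_isVolterraSolution φ).choose_spec

/-! ### The flow of a Volterra equation -/

theorem duhamel_add (hA : IsLipschitzFamily A L) (u : C(ℝ≥0, X)) (s t θ : ℝ≥0) :
    duhamel A u (s + t) θ = duhamel A u s (t + θ) + duhamel A (shiftPath s u) t θ := by
  have integrable (a b : ℝ) := hA.intervalIntegrable u (s + t + θ) a b
  have past : duhamel A u s (t + θ) =
      ∫ τ in (0 : ℝ)..s, A (s + t + θ - τ : ℝ).toNNReal (u τ.toNNReal) := by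
    rw [duhamel, NNReal.coe_add, add_assoc]
  have future : duhamel A (shiftPath s u) t θ =
      ∫ τ in (s : ℝ)..s + t, A (s + t + θ - τ : ℝ).toNNReal (u τ.toNNReal) := by
    have translation := intervalIntegral.integral_comp_add_left (a := 0) (b := (t : ℝ))
      (fun τ => A (s + t + θ - τ : ℝ).toNNReal (u τ.toNNReal)) s
    rw [add_zero] at translation
    rw [← translation]
    refine intervalIntegral.integral_congr fun τ hτ => ?_
    rw [uIcc_of_le t.coe_nonneg] at hτ
    simp only [shiftPath_apply, Real.toNNReal_add s.coe_nonneg hτ.1, Real.toNNReal_coe]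
    congr 2
    ring
  rw [past, future, intervalIntegral.integral_add_adjacent_intervals (integrable _ _)
    (integrable _ _), duhamel, NNReal.coe_add]

variable [CompleteSpace X]

/-- The operators `T_t` on forcing terms: the restart of the equation at time `t` from the
forcing term `φ` is the equation with forcing term `T_t φ`. -/
noncomputable def flow (hA : IsLipschitzFamily A L) (t : ℝ≥0) (φ : C(ℝ≥0, X)) : C(ℝ≥0, X) where
  toFun θ := φ (t + θ) + duhamel A (hA.solution φ) t θ
  continuous_toFun :=
    (shiftPath t φ).continuous.add ((hA.continuous_duhamel _).comp (Continuous.prodMk_right t))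

theorem flow_apply (hA : IsLipschitzFamily A L) (t : ℝ≥0) (φ : C(ℝ≥0, X)) (θ : ℝ≥0) :
    hA.flow t φ θ = φ (t + θ) + duhamel A (hA.solution φ) t θ :=
  rfl

theorem flow_zero (hA : IsLipschitzFamily A L) (φ : C(ℝ≥0, X)) : hA.flow 0 φ = φ := by
  ext θ
  rw [flow_apply, duhamel_zero_left, zero_add, add_zero]

theorem solution_flow (hA : IsLipschitzFamily A L) (s : ℝ≥0) (φ : C(ℝ≥0, X)) :
    hA.solution (hA.flow s φ) = shiftPath s (hA.solution φ) := by
  refine hA.eq_of_isVolterraSolution (hA.isVolterraSolution_solution _) fun t => ?_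
  rw [flow_apply, add_assoc]
  simpa only [shiftPath_apply, hA.duhamel_add, add_zero] using
    hA.isVolterraSolution_solution φ (s + t)

theorem flow_add (hA : IsLipschitzFamily A L) (s t : ℝ≥0) (φ : C(ℝ≥0, X)) :
    hA.flow (s + t) φ = hA.flow t (hA.flow s φ) := by
  ext θ
  rw [flow_apply, flow_apply, flow_apply, solution_flow, hA.duhamel_add, add_assoc s t θ,
    add_assoc]

theorem norm_flow_sub_le (hA : IsLipschitzFamily A L) {φ ψ : C(ℝ≥0, X)} {C : ℝ} {t θ : ℝ≥0}
    (h : ∀ r ≤ t + θ, ‖φ r - ψ r‖ ≤ C) :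
    ‖hA.flow t φ θ - hA.flow t ψ θ‖ ≤ (1 + Real.exp (2 * L * t)) * C := by
  have solution_sub_le (τ : ℝ≥0) (hτ : τ ≤ t) :
      ‖hA.solution φ τ - hA.solution ψ τ‖ ≤ 2 * C * Real.exp (2 * L * τ) :=
    hA.norm_sub_le_of_isVolterraSolution (hA.isVolterraSolution_solution φ)
      (hA.isVolterraSolution_solution ψ) (fun r hr => h r (hr.trans le_self_add)) hτ
  rw [flow_apply, flow_apply, add_sub_add_comm]
  refine (norm_add_le_of_le (h _ le_rfl) (hA.norm_duhamel_sub_le solution_sub_le θ)).trans_eq ?_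
  ring

end IsLipschitzFamily

end Volterra

/-! ### The metric of uniform convergence on compact sets -/

theorem div_one_add_le_mul_div_one_add {a b C : ℝ} (ha : 0 ≤ a) (hb : 0 ≤ b) (hC : 1 ≤ C)
    (hab : a ≤ C * b) : a / (1 + a) ≤ C * (b / (1 + b)) := by
  rw [← mul_div_assoc, div_le_div_iff₀ (by positivity) (by positivity)]
  have := le_mul_of_one_le_left (mul_nonneg ha hb) hC
  linarith

section Rho

variable {𝕜 : Type} [RCLike 𝕜] {d : ℕ} {p : ℝ≥0∞} [Fact (1 ≤ p)]

theorem norm_sub_le_supDist (n : ℕ) (φ h : PathSpace 𝕜 d p) {t : ℝ≥0} (ht : t ≤ n) :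
    ‖φ t - h t‖ ≤ supDist n φ h :=
  le_csSup (isCompact_Icc.image (by fun_prop)).bddAbove ⟨t, ⟨zero_le, ht⟩, rfl⟩

theorem supDist_le {n : ℕ} {φ h : PathSpace 𝕜 d p} {C : ℝ}
    (hC : ∀ t : ℝ≥0, t ≤ n → ‖φ t - h t‖ ≤ C) : supDist n φ h ≤ C :=
  csSup_le ((nonempty_Icc.2 zero_le).image _) (forall_mem_image.2 fun t ht => hC t ht.2)

theorem supDist_nonneg (n : ℕ) (φ h : PathSpace 𝕜 d p) : 0 ≤ supDist n φ h :=
  (norm_nonneg _).trans (norm_sub_le_supDist n φ h zero_le)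

theorem summable_rho (φ h : PathSpace 𝕜 d p) : Summable fun n : ℕ =>
    (1 / 2 ^ (n + 1) : ℝ) * (supDist (n + 1) φ h / (1 + supDist (n + 1) φ h)) := by
  have summable_geometric : Summable fun n : ℕ => (1 / 2 ^ (n + 1) : ℝ) := by
    simpa only [one_div_pow] using (summable_nat_add_iff 1).2 summable_geometric_two
  refine Summable.of_nonneg_of_le (fun n => ?_) (fun n => ?_) summable_geometric
  · have := supDist_nonneg (n + 1) φ h
    positivity
  · exact mul_le_of_le_one_right (by positivity) (div_le_one_of_le₀ (le_add_of_nonneg_left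
      zero_le_one) (add_nonneg zero_le_one (supDist_nonneg _ _ _)))

theorem rho_le_of_supDist_le {φ₁ ψ₁ φ ψ : PathSpace 𝕜 d p} {C : ℝ} (hC : 1 ≤ C) (N : ℕ)
    (h : ∀ n : ℕ, supDist (n + 1) φ₁ ψ₁ ≤ C * supDist (n + N + 1) φ ψ) :
    rho φ₁ ψ₁ ≤ C * 2 ^ N * rho φ ψ := by
  set g : ℕ → ℝ := fun n =>
    (1 / 2 ^ (n + 1)) * (supDist (n + 1) φ ψ / (1 + supDist (n + 1) φ ψ))
  have g_nonneg (n : ℕ) : 0 ≤ g n := by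
    have := supDist_nonneg (n + 1) φ ψ
    positivity
  have term_le (n : ℕ) : (1 / 2 ^ (n + 1)) * (supDist (n + 1) φ₁ ψ₁ /
      (1 + supDist (n + 1) φ₁ ψ₁)) ≤ C * 2 ^ N * g (n + N) := by
    calc (1 / 2 ^ (n + 1)) * (supDist (n + 1) φ₁ ψ₁ / (1 + supDist (n + 1) φ₁ ψ₁))
        ≤ (1 / 2 ^ (n + 1)) *
          (C * (supDist (n + N + 1) φ ψ / (1 + supDist (n + N + 1) φ ψ))) := by
          gcongr
          exact div_one_add_le_mul_div_one_add (supDist_nonneg _ _ _) (supDist_nonneg _ _ _)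
            hC (h n)
      _ = C * 2 ^ N * g (n + N) := by
          simp only [g, pow_add]
          field_simp
  have summable_shift : Summable fun n => g (n + N) :=
    (summable_nat_add_iff N).2 (summable_rho φ ψ)
  calc rho φ₁ ψ₁ ≤ ∑' n, C * 2 ^ N * g (n + N) :=
        (summable_rho φ₁ ψ₁).tsum_le_tsum term_le (summable_shift.mul_left _)
    _ = C * 2 ^ N * ∑' n, g (n + N) := tsum_mul_left
    _ ≤ C * 2 ^ N * ∑' n, g n := mul_le_mul_of_nonneg_left
        (summable_shift.tsum_le_tsum_of_inj (· + N) (add_left_injective N)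
          (fun n _ => g_nonneg n) (fun n => le_rfl) (summable_rho φ ψ)) (by positivity)

end Rho

/-! ### The semilinear equation -/

section Semilinear

variable {𝕜 : Type} [RCLike 𝕜] {d : ℕ} {p : ℝ≥0∞} [Fact (1 ≤ p)] {k : ℝ → ℝ}
  {f : LpSpace 𝕜 d p → LpSpace 𝕜 d p} {L : ℝ≥0}

theorem IsLogConvexKernel.isLipschitzFamily_solutionOperator
    (hm : IsLogConvexKernel fun r => 1 + k r) (hp : p ≠ ∞) (hf : LipschitzWith L f) :
    IsLipschitzFamily (fun (t : ℝ≥0) x => solutionOperator k t (f x)) L where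
  lipschitz t := LipschitzWith.of_dist_le_mul fun u v => by
    rw [dist_eq_norm, ← hm.solutionOperator_sub hp t.coe_nonneg, dist_eq_norm]
    exact (hm.norm_solutionOperator_le t.coe_nonneg _).trans (hf.norm_sub_le u v)
  stronglyMeasurable x := hm.stronglyMeasurable_solutionOperator hp (f x)
  bounded_zero := ⟨‖f 0‖, fun t => hm.norm_solutionOperator_le t.coe_nonneg _⟩

theorem duhamelIntegrand_eqOn (k : ℝ → ℝ) (f : LpSpace 𝕜 d p → LpSpace 𝕜 d p)
    (u : PathSpace 𝕜 d p) (t θ : ℝ≥0) :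
    EqOn (duhamelIntegrand k f u (t + θ))
      (fun τ => solutionOperator k (t + θ - τ : ℝ).toNNReal (f (u τ.toNNReal))) (uIcc 0 t) := by
  intro τ hτ
  rw [uIcc_of_le t.coe_nonneg] at hτ
  simp only [duhamelIntegrand]
  rw [Real.coe_toNNReal _ (by linarith [hτ.2, θ.coe_nonneg])]

theorem integral_duhamelIntegrand (k : ℝ → ℝ) (f : LpSpace 𝕜 d p → LpSpace 𝕜 d p)
    (u : PathSpace 𝕜 d p) (t θ : ℝ≥0) :
    ∫ τ in (0 : ℝ)..t, duhamelIntegrand k f u (t + θ) τ =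
      duhamel (fun (t : ℝ≥0) x => solutionOperator k t (f x)) u t θ :=
  intervalIntegral.integral_congr (duhamelIntegrand_eqOn k f u t θ)

theorem IsLipschitzFamily.intervalIntegrable_duhamelIntegrand
    (hA : IsLipschitzFamily (fun (t : ℝ≥0) x => solutionOperator k t (f x)) L)
    (u : PathSpace 𝕜 d p) (t θ : ℝ≥0) :
    IntervalIntegrable (duhamelIntegrand k f u (t + θ)) volume 0 t :=
  (hA.intervalIntegrable u (t + θ) 0 t).congr
    ((duhamelIntegrand_eqOn k f u t θ).symm.mono uIoc_subset_uIcc)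

theorem IsLipschitzFamily.isGeneralizedMildSolution_iff
    (hA : IsLipschitzFamily (fun (t : ℝ≥0) x => solutionOperator k t (f x)) L)
    (φ u : PathSpace 𝕜 d p) :
    IsGeneralizedMildSolution k f φ u ↔
      IsVolterraSolution (fun (t : ℝ≥0) x => solutionOperator k t (f x)) φ u := by
  refine forall_congr' fun t => ?_
  have integrable := hA.intervalIntegrable_duhamelIntegrand u t 0
  have integral_eq := integral_duhamelIntegrand k f u t 0
  rw [NNReal.coe_zero, add_zero] at integrable integral_eq
  rw [integral_eq]
  exact and_iff_right integrable

theorem IsLipschitzFamily.exists_rho_flow_le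
    {A : ℝ≥0 → LpSpace 𝕜 d p → LpSpace 𝕜 d p} (hA : IsLipschitzFamily A L) (t : ℝ≥0) :
    ∃ K : ℝ, 0 ≤ K ∧ ∀ φ ψ : PathSpace 𝕜 d p,
      rho (hA.flow t φ) (hA.flow t ψ) ≤ K * rho φ ψ := by
  obtain ⟨N, hN⟩ := exists_nat_ge t
  refine ⟨(1 + Real.exp (2 * L * t)) * 2 ^ N, by positivity, fun φ ψ => ?_⟩
  refine rho_le_of_supDist_le (le_add_of_nonneg_right (Real.exp_pos _).le) N fun n =>
    supDist_le fun θ hθ => hA.norm_flow_sub_le fun r hr => norm_sub_le_supDist _ φ ψ ?_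
  calc r ≤ t + θ := hr
    _ ≤ N + (n + 1 : ℕ) := add_le_add hN hθ
    _ = (n + N + 1 : ℕ) := by push_cast; ring

theorem mainTheorem5_general (hp : p ≠ ∞) (hm : IsLogConvexKernel fun r => 1 + k r)
    (hf : LipschitzWith L f) :
    (∀ φ : PathSpace 𝕜 d p, ∃! u : PathSpace 𝕜 d p, IsGeneralizedMildSolution k f φ u) ∧
    ∃ T : ℝ≥0 → PathSpace 𝕜 d p → PathSpace 𝕜 d p,
      (∀ φ u : PathSpace 𝕜 d p, IsGeneralizedMildSolution k f φ u → ∀ t θ : ℝ≥0,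
        IntervalIntegrable (duhamelIntegrand k f u (t + θ)) volume 0 t ∧
        T t φ θ = φ (t + θ) + ∫ τ in (0 : ℝ)..t, duhamelIntegrand k f u (t + θ) τ) ∧
      T 0 = id ∧
      (∀ t s : ℝ≥0, T (t + s) = T t ∘ T s) ∧
      ∀ t : ℝ≥0, ∃ K : ℝ, 0 ≤ K ∧
        ∀ φ ψ : PathSpace 𝕜 d p, rho (T t φ) (T t ψ) ≤ K * rho φ ψ := by
  have hA := hm.isLipschitzFamily_solutionOperator hp hf
  have isSolution (φ : PathSpace 𝕜 d p) : IsGeneralizedMildSolution k f φ (hA.solution φ) :=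
    (hA.isGeneralizedMildSolution_iff φ _).2 (hA.isVolterraSolution_solution φ)
  have eq_solution {φ u : PathSpace 𝕜 d p} (hu : IsGeneralizedMildSolution k f φ u) :
      u = hA.solution φ := hA.eq_of_isVolterraSolution
    ((hA.isGeneralizedMildSolution_iff φ u).1 hu) (hA.isVolterraSolution_solution φ)
  refine ⟨fun φ => ⟨hA.solution φ, isSolution φ, fun u => eq_solution⟩, hA.flow, ?_,
    funext hA.flow_zero, ?_, hA.exists_rho_flow_le⟩
  · intro φ u hu t θ
    rw [integral_duhamelIntegrand, eq_solution hu]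
    exact ⟨hA.intervalIntegrable_duhamelIntegrand _ t θ, hA.flow_apply t φ θ⟩
  · intro t s
    ext1 φ
    rw [add_comm, hA.flow_add, Function.comp_apply]

end Semilinear

end RayleighStokes

theorem mainTheorem5 {𝕜 : Type} [RCLike 𝕜] (d : ℕ) (p : ℝ≥0∞) [Fact (1 ≤ p)] (hp : p ≠ ∞)
    (k : ℝ → ℝ) (hk : RayleighStokes.IsCompletelyMonotone k)
    (hk_int : RayleighStokes.IsLocallyIntegrableKernel k)
    (f : RayleighStokes.LpSpace 𝕜 d p → RayleighStokes.LpSpace 𝕜 d p)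
    (hf : RayleighStokes.ConditionFf f) :
    (∀ φ : RayleighStokes.PathSpace 𝕜 d p,
      ∃! u : RayleighStokes.PathSpace 𝕜 d p, RayleighStokes.IsGeneralizedMildSolution k f φ u) ∧
    ∃ T : ℝ≥0 → RayleighStokes.PathSpace 𝕜 d p → RayleighStokes.PathSpace 𝕜 d p,
      (∀ φ u : RayleighStokes.PathSpace 𝕜 d p, RayleighStokes.IsGeneralizedMildSolution k f φ u →
        ∀ t θ : ℝ≥0,
          IntervalIntegrable (RayleighStokes.duhamelIntegrand k f u (t + θ)) volume 0 t ∧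
          T t φ θ =
            φ (t + θ) + ∫ τ in (0 : ℝ)..t, RayleighStokes.duhamelIntegrand k f u (t + θ) τ) ∧
      T 0 = id ∧
      (∀ t s : ℝ≥0, T (t + s) = T t ∘ T s) ∧
      ∀ t : ℝ≥0, ∃ K : ℝ, 0 ≤ K ∧
        ∀ φ ψ : RayleighStokes.PathSpace 𝕜 d p,
          RayleighStokes.rho (T t φ) (T t ψ) ≤ K * RayleighStokes.rho φ ψ := by
  obtain ⟨_, L, _, hL⟩ := hf
  exact RayleighStokes.mainTheorem5_general hp (hk.isLogConvexKernel_one_add hk_int)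
    (LipschitzWith.of_dist_le' (K := L) fun u v => by simpa only [dist_eq_norm] using hL u v)
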